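/- For a matrix $M$ with $r$ rows and entries in $\{0,1,-1\}$, divide a rectangle into unit cells according to the rows and columns of $M$ and draw in each cell the diagonal of slope $1$ if the corresponding entry is $1$, the diagonal of slope $-1$ if it is $-1$, and nothing if it is $0$. Let $\mathcal{G}_n(M)\subseteq S_n$ be the set of permutations obtained by placing $n$ dots on these segments, no two with the same $x$- or $y$-coordinate, labeling the dots $1,\dots,n$ by increasing $y$-coordinate, and reading the labels by increasing $x$-coordinate. Let $$\mathcal{J}_n:=\mathcal{G}_n\begin{pmatrix}0&1\\1&0\\1&0\\0&1\end{pmatrix},$$ that is, the grid class of the $2$-colayered grid $\begin{pmatrix}1&0\\0&1\end{pmatrix}$ with an increasing segment of full width stacked on top of it. For $D\subseteq[n-1]$ let $F_{n,D}:=\sum x_{i_1}x_{i_2}\cdots x_{i_n}$ be the fundamental quasisymmetric function, where the sum is over all $i_1\le i_2\le\cdots\le i_n$ with $i_j<i_{j+1}$ for $j\in D$. For $\mathcal{B}\subseteq S_n$ let $\mathcal{Q}(\mathcal{B}):=\sum_{\pi\in\mathcal{B}}F_{n,\mathrm{Des}(\pi)}$, where $\mathrm{Des}(\pi)=\{i:\pi(i)>\pi(i+1)\}$.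 The set $\mathcal{B}$ is called fine if $\mathcal{Q}(\mathcal{B})$ is a symmetric function and is a linear combination with nonnegative coefficients of the Schur functions $s_\lambda$, $\lambda\vdash n$. **Proposition.** For every $n\ge 0$, the set $\mathcal{J}_n$ is fine, and $$\mathcal{Q}(\mathcal{J}_n)=s_n+\sum_{a=1}^{\lfloor n/2\rfloor}(n-2a+1)\,s_{n-a,a}+\sum_{a=1}^{\lfloor (n-1)/2\rfloor}(n-2a)\,s_{n-a-1,a,1}.$$ -/

import Mathlib

noncomputable section

namespace StackedGrid

/-! ### Geometric grid classes -/

/-- The figure of a matrix `M` with entries in `{0, 1, -1}`. The cell in row `i` (rows are counted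
from the top, starting at `0`) and column `j` is the unit square with lower left corner
`(j, r - 1 - i)`; it contains its diagonal of slope `1` if `M i j = 1`, its diagonal of slope `-1`
if `M i j = -1`, and nothing if `M i j = 0`. -/
def gridFigure {r c : ℕ} (M : Matrix (Fin r) (Fin c) SignType) : Set (ℝ × ℝ) :=
  {p | ∃ (i : Fin r) (j : Fin c) (t : ℝ), 0 ≤ t ∧ t ≤ 1 ∧
    p.1 = (j : ℝ) + t ∧
    ((M i j = 1 ∧ p.2 = ((r : ℝ) - 1 - (i : ℝ)) + t) ∨
      (M i j = -1 ∧ p.2 = ((r : ℝ) - 1 - (i : ℝ)) + (1 - t)))}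

/-- `𝒢ₙ(M)`: the permutations that are obtained by placing `n` dots on the figure of `M`, no two
with the same `x`- or `y`-coordinate, labelling them by increasing `y`-coordinate, and reading the
labels by increasing `x`-coordinate. Here `p k` is the `k`-th dot from the left, and
`π k` is its label. -/
def gridClass {r c : ℕ} (M : Matrix (Fin r) (Fin c) SignType) (n : ℕ) :
    Set (Equiv.Perm (Fin n)) :=
  {π | ∃ p : Fin n → ℝ × ℝ, (∀ k, p k ∈ gridFigure M) ∧
    (∀ k l, k < l → (p k).1 < (p l).1) ∧
    (∀ k l, π k < π l ↔ (p k).2 < (p l).2)}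

/-- The matrix of the grid `𝒥`: an increasing segment (spanning both columns, hence the two upper
rows) on top of the two-colayered grid, whose matrix is the `2 × 2` identity matrix. -/
def matrixJ : Matrix (Fin 4) (Fin 2) SignType :=
  !![0, 1;
     1, 0;
     1, 0;
     0, 1]

/-- The stacked grid class `𝒥ₙ`. -/
def classJ (n : ℕ) : Set (Equiv.Perm (Fin n)) := gridClass matrixJ n

/-! ### Quasisymmetric and symmetric functions

Quasisymmetric and symmetric functions are formal power series over `ℚ` in the variables
`x₀, x₁, x₂, …`. -/

/-- The descent set of `π`, as a subset of the `n - 1` positions `0, …, n - 2`. -/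
def Des {n : ℕ} (π : Equiv.Perm (Fin n)) : Finset (Fin (n - 1)) :=
  {j | π ⟨(j : ℕ) + 1, by omega⟩ < π ⟨(j : ℕ), by omega⟩}

/-- The index sequences `i₁ ≤ i₂ ≤ … ≤ iₙ` with `i_j < i_{j+1}` whenever `j ∈ D`. -/
def IsIndexSeq {n : ℕ} (D : Finset (Fin (n - 1))) (i : Fin n → ℕ) : Prop :=
  Monotone i ∧ ∀ j ∈ D, i ⟨(j : ℕ), by omega⟩ < i ⟨(j : ℕ) + 1, by omega⟩

/-- Gessel's fundamental quasisymmetric function `F_{n,D}`, the sum of the monomials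
`x_{i₁} x_{i₂} ⋯ x_{iₙ}` over the index sequences for `D`: the coefficient of the monomial with
exponent vector `m` is the number of those sequences that give this monomial. -/
def fundamentalQSym (n : ℕ) (D : Finset (Fin (n - 1))) : MvPowerSeries ℕ ℚ :=
  fun m => (Nat.card {i : Fin n → ℕ //
    IsIndexSeq D i ∧ ∑ k, Finsupp.single (i k) 1 = m} : ℚ)

open Classical in
/-- `𝒬(B) = ∑_{π ∈ B} F_{n, Des π}` for a set `B` of permutations. -/
def quasiGen {n : ℕ} (B : Set (Equiv.Perm (Fin n))) : MvPowerSeries ℕ ℚ :=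
  ∑ π : Equiv.Perm (Fin n) with π ∈ B, fundamentalQSym n (Des π)

/-- The Schur function `s_μ = ∑_T x^T`, the sum being over all semistandard Young tableaux `T` of
shape `μ`: the coefficient of the monomial with exponent vector `m` is the number of tableaux of
content `m`. -/
def schur (μ : YoungDiagram) : MvPowerSeries ℕ ℚ :=
  fun m => (Nat.card {T : SemistandardYoungTableau μ //
    ∑ c ∈ μ.cells, Finsupp.single (T c.1 c.2) 1 = m} : ℚ)

open Classical in
/-- The Schur function `s_{w₁, w₂, …}` of the partition with row lengths `w₁ ≥ w₂ ≥ …`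
(and `0` if `w` is not weakly decreasing, a case which is never used). -/
def schurOfRows (w : List ℕ) : MvPowerSeries ℕ ℚ :=
  if hw : w.SortedGE then schur (YoungDiagram.ofRowLens w hw) else 0

/-- `f` is a homogeneous symmetric function of degree `n`. -/
def IsSymmetricFunction (n : ℕ) (f : MvPowerSeries ℕ ℚ) : Prop :=
  (∀ m : ℕ →₀ ℕ, MvPowerSeries.coeff m f ≠ 0 → m.degree = n) ∧
  ∀ (σ : Equiv.Perm ℕ) (m : ℕ →₀ ℕ),
    MvPowerSeries.coeff (m.mapDomain σ) f = MvPowerSeries.coeff m f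

/-- `f` is a linear combination with nonnegative coefficients of the Schur functions `s_μ`, `μ` a
partition of `n`. -/
def IsSchurPositive (n : ℕ) (f : MvPowerSeries ℕ ℚ) : Prop :=
  ∃ c : YoungDiagram →₀ ℚ, (∀ μ ∈ c.support, μ.card = n) ∧ (∀ μ, 0 ≤ c μ) ∧
    f = c.sum fun μ a => a • schur μ

/-- A set of permutations of `n` letters is fine if its quasisymmetric generating function is
symmetric and Schur-positive. -/
def IsFine {n : ℕ} (B : Set (Equiv.Perm (Fin n))) : Prop :=
  IsSymmetricFunction n (quasiGen B) ∧ IsSchurPositive n (quasiGen B)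

end StackedGrid

end

/-! ### Coefficients in products of complete homogeneous functions, and summation by parts. -/

namespace StackedGrid

/-! Both sides are compared coefficient by coefficient. For an exponent vector `m` of degree `n`,
each coefficient equals `2 + E - S`, where `S = ∏ (m k + 1)` (`subCount`) and `E = ∑ m k * ∏_{j ≠ k}
(m j + 1)` (`subCountErase`).

Permutation side: cut the positions into consecutive blocks of sizes `m 0, m 1, …`. The coefficient
of `x^m` in `F_{n, Des π}` is 1 if `π` increases on every block and 0 otherwise. A permutation of
the class is the standardization of a word in `0, 1, 2` recording the segment of each dot, numbered
upwards; the only constraint is that no `0` precedes a `1`. Every such permutation comes from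
exactly one canonical word (`mem_classJ_iff`, `IsTight.injective`), and increasing on blocks means
that the word is weakly increasing on blocks. Adding one block at a time gives `1` constant word, `S
- n - 1` two-letter words and `E - 2 S + n + 2` three-letter words (`ncard_canonical`).

Schur side: the shapes have at most three rows, the third of length at most 1, so their Kostka
numbers are short Jacobi–Trudi combinations of coefficients of `h_q h_{n-q}` and `h_1 h_q
h_{n-1-q}`. These are proved by removing the largest letter and telescoping
(`tableauCount_two_rows`, `tableauCount_three_rows`). The weights `n - 2a + 1` and `n - 2a` are
linear in `a`, so summation by parts and the symmetry `q ↔ n - q` turn the weighted sums into full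
sums over `q`, which are `S` and `E` (`one_add_sum_coeff`).

Schur positivity is read off from the expansion, and symmetry from the common coefficient, which
depends only on the multiset of exponents. -/

/-- The partial sums of a sequence of block sizes. -/
def psum (m : ℕ → ℕ) : ℕ → ℕ
  | 0 => 0
  | k + 1 => psum m k + m k

/-- The coefficient of `x^m` in `h_q h_{n-q}`, for the variables `x₀, …, x_{N-1}`. -/
def coeffHH (m : ℕ → ℕ) : ℕ → ℤ → ℤ
  | 0, q => if q = 0 then 1 else 0
  | N + 1, q => ∑ b ∈ Finset.range (m N + 1), coeffHH m N (q - b)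

/-- The coefficient of `x^m` in `h_1 h_q h_{n-1-q}`, for the variables `x₀, …, x_{N-1}`. -/
def coeffHHH (m : ℕ → ℕ) : ℕ → ℤ → ℤ
  | 0, _ => 0
  | N + 1, q => ∑ b ∈ Finset.range (m N + 1), coeffHHH m N (q - b) +
      ∑ b ∈ Finset.range (m N), coeffHH m N (q - b)

/-- The number of contents that are at most `m`. -/
def subCount (m : ℕ → ℕ) : ℕ → ℤ
  | 0 => 1
  | N + 1 => subCount m N * (m N + 1)

/-- The number of pairs of a variable `c` and a content that is at most `m` with one `c` removed. -/
def subCountErase (m : ℕ → ℕ) : ℕ → ℤ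
  | 0 => 0
  | N + 1 => subCountErase m N * (m N + 1) + subCount m N * m N

variable (m : ℕ → ℕ)

theorem coeffHH_of_neg (N : ℕ) (q : ℤ) (hq : q < 0) : coeffHH m N q = 0 := by
  induction N generalizing q with
  | zero => simp [coeffHH, hq.ne]
  | succ N ih => exact Finset.sum_eq_zero fun b _ => ih _ (by omega)

theorem coeffHHH_of_neg (N : ℕ) (q : ℤ) (hq : q < 0) : coeffHHH m N q = 0 := by
  induction N generalizing q with
  | zero => rfl
  | succ N ih =>
    rw [coeffHHH, Finset.sum_eq_zero fun b _ => ih _ (by omega),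
      Finset.sum_eq_zero fun b _ => coeffHH_of_neg m N _ (by omega), add_zero]

/-- The two factors of `h_q h_{n-q}` commute: in each variable, exchange the `b` copies given to one
factor with the remaining `m N - b`. -/
theorem coeffHH_symm (N : ℕ) (q : ℤ) : coeffHH m N (psum m N - q) = coeffHH m N q := by
  induction N generalizing q with
  | zero => simp [coeffHH, psum]
  | succ N ih =>
    rw [coeffHH, coeffHH, ← Finset.sum_range_reflect]
    refine Finset.sum_congr rfl fun b hb => ?_
    rw [Finset.mem_range] at hb
    rw [← ih]
    congr 1
    simp only [psum]
    push_cast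
    omega

theorem coeffHHH_symm (N : ℕ) (q : ℤ) : coeffHHH m N (psum m N - 1 - q) = coeffHHH m N q := by
  induction N generalizing q with
  | zero => rfl
  | succ N ih =>
    rw [coeffHHH, coeffHHH, ← Finset.sum_range_reflect,
      ← Finset.sum_range_reflect (fun b : ℕ => coeffHH m N (psum m (N + 1) - 1 - q - b))]
    congr 1 <;> refine Finset.sum_congr rfl fun b hb => ?_ <;> rw [Finset.mem_range] at hb
    · rw [← ih]
      congr 1
      simp only [psum]
      push_cast
      omega
    · rw [← coeffHH_symm]
      congr 1
      simp only [psum]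
      push_cast
      omega

theorem coeffHH_of_gt (N : ℕ) (q : ℤ) (hq : psum m N < q) : coeffHH m N q = 0 := by
  rw [← coeffHH_symm]
  exact coeffHH_of_neg _ _ _ (by omega)

theorem coeffHHH_of_gt (N : ℕ) (q : ℤ) (hq : psum m N ≤ q) : coeffHHH m N q = 0 := by
  rw [← coeffHHH_symm]
  exact coeffHHH_of_neg _ _ _ (by omega)

theorem coeffHH_zero (N : ℕ) : coeffHH m N 0 = 1 := by
  induction N with
  | zero => rfl
  | succ N ih =>
    rw [coeffHH, Finset.sum_range_succ', Finset.sum_eq_zero fun b _ => coeffHH_of_neg m N _ _]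
    · simpa using ih
    · intro b _
      push_cast
      omega

/-- This is `h_1 h_0 h_{n-1} = h_1 h_{n-1}`. It cancels boundary terms in the summation by parts and
in the three-row Kostka numbers. -/
theorem coeffHHH_zero (N : ℕ) : coeffHHH m N 0 = coeffHH m N 1 := by
  induction N with
  | zero => rfl
  | succ N ih =>
    rw [coeffHHH, coeffHH]
    have h0 : ∀ k, ∑ b ∈ Finset.range k, coeffHH m N (0 - b) = if k = 0 then 0 else 1 := by
      intro k
      cases k with
      | zero => simp
      | succ k =>
        rw [Finset.sum_range_succ', Finset.sum_eq_zero fun b _ => coeffHH_of_neg m N _ _]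
        · simpa using coeffHH_zero m N
        · intro b _
          push_cast
          omega
    have h1 : ∑ b ∈ Finset.range (m N + 1), coeffHHH m N (0 - b) = coeffHHH m N 0 := by
      rw [Finset.sum_range_succ', Finset.sum_eq_zero fun b _ => coeffHHH_of_neg m N _ _]
      · simp
      · intro b _
        push_cast
        omega
    rw [h1, h0, Finset.sum_range_succ', ih, add_comm]
    have h2 := h0 (m N)
    have h3 : ∀ b : ℕ, (1 : ℤ) - ((b + 1 : ℕ) : ℤ) = 0 - b := by
      intro b
      push_cast
      ring
    simp only [h3, h0]
    simp

/-- Two windows of `m N + 1` consecutive indices, shifted by one, differ only at their ends. Kostka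
numbers are such differences, so this is their recursion in the number of variables. -/
theorem coeffHH_succ_sub (N : ℕ) (q : ℤ) :
    coeffHH m (N + 1) q - coeffHH m (N + 1) (q - 1) =
      coeffHH m N q - coeffHH m N (q - m N - 1) := by
  rw [coeffHH, coeffHH, Finset.sum_range_succ', Finset.sum_range_succ]
  have : ∀ b : ℕ, q - ((b + 1 : ℕ) : ℤ) = q - 1 - b := by
    intro b
    push_cast
    ring
  simp only [this]
  rw [show q - 1 - (m N : ℤ) = q - m N - 1 by ring]
  simp

theorem coeffHHH_succ_sub (N : ℕ) (q : ℤ) :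
    coeffHHH m (N + 1) q - coeffHHH m (N + 1) (q - 1) =
      coeffHHH m N q - coeffHHH m N (q - m N - 1) +
        (coeffHH m N q - coeffHH m N (q - m N)) := by
  have key : ∀ (f : ℤ → ℤ) (k : ℕ), ∑ b ∈ Finset.range k, f (q - b) -
      ∑ b ∈ Finset.range k, f (q - 1 - b) = f q - f (q - k) := by
    intro f k
    rw [← Finset.sum_sub_distrib]
    have := Finset.sum_range_sub' (fun b : ℕ => f (q - b)) k
    simp only [Nat.cast_zero, sub_zero] at this
    rw [← this]
    refine Finset.sum_congr rfl fun b _ => ?_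
    rw [show q - 1 - (b : ℤ) = q - ((b + 1 : ℕ) : ℤ) by push_cast; ring]
  have h1 := key (coeffHHH m N) (m N + 1)
  have h2 := key (coeffHH m N) (m N)
  rw [coeffHHH, coeffHHH]
  rw [show q - ((m N + 1 : ℕ) : ℤ) = q - m N - 1 by push_cast; ring] at h1
  linarith

theorem sum_range_shift (f : ℤ → ℤ) (M e b : ℕ) (hb : b ≤ e) (h0 : ∀ q < 0, f q = 0)
    (h1 : ∀ q : ℤ, (M : ℤ) ≤ q → f q = 0) :
    ∑ q ∈ Finset.range (M + e), f ((q : ℤ) - b) = ∑ q ∈ Finset.range M, f q := by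
  obtain ⟨d, rfl⟩ := Nat.exists_eq_add_of_le hb
  rw [show M + (b + d) = b + (M + d) by ring, Finset.sum_range_add, Finset.sum_range_add,
    Finset.sum_eq_zero (s := Finset.range b), Finset.sum_eq_zero (s := Finset.range d)]
  · simp
  · intro x _
    exact h1 _ (by push_cast; omega)
  · intro x hx
    rw [Finset.mem_range] at hx
    exact h0 _ (by omega)

/-- Summing over `q` forgets the degree of the first factor, leaving a free choice of how many
copies of each variable it receives. -/
theorem sum_coeffHH (N : ℕ) :
    ∑ q ∈ Finset.range (psum m N + 1), coeffHH m N q = subCount m N := by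
  induction N with
  | zero => simp [psum, coeffHH, subCount]
  | succ N ih =>
    simp only [coeffHH]
    rw [Finset.sum_comm, Finset.sum_congr rfl fun b hb => ?_, Finset.sum_const, subCount]
    rotate_left
    · exact subCount m N
    · rw [psum, show psum m N + m N + 1 = psum m N + 1 + m N by ring,
        sum_range_shift _ _ _ _ (by simpa [Nat.lt_succ_iff] using hb) (coeffHH_of_neg m N), ih]
      intro q hq
      exact coeffHH_of_gt _ _ _ (by push_cast at hq; omega)
    · simp [mul_comm]

theorem sum_coeffHHH (N : ℕ) :
    ∑ q ∈ Finset.range (psum m N), coeffHHH m N q = subCountErase m N := by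
  induction N with
  | zero => simp [psum, subCountErase]
  | succ N ih =>
    simp only [coeffHHH, Finset.sum_add_distrib]
    rw [Finset.sum_comm, Finset.sum_congr rfl fun b hb => ?_, Finset.sum_const, subCountErase]
    rotate_left
    · exact subCountErase m N
    · rw [psum, sum_range_shift _ _ _ _ (by simpa [Nat.lt_succ_iff] using hb)
        (coeffHHH_of_neg m N) (coeffHHH_of_gt m N), ih]
    rw [Finset.sum_comm, Finset.sum_congr rfl fun b hb => ?_, Finset.sum_const]
    rotate_left
    · exact subCount m N
    · rw [Finset.mem_range] at hb
      rw [psum, show psum m N + m N = psum m N + 1 + (m N - 1) by omega,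
        sum_range_shift _ _ _ _ (by omega) (coeffHH_of_neg m N), sum_coeffHH]
      intro q hq
      exact coeffHH_of_gt _ _ _ (by push_cast at hq; omega)
    · simp [mul_comm]

/-- Summation by parts for a sequence that is symmetric under `q ↦ n - q`. -/
theorem sum_weighted_sub (n : ℕ) (f : ℤ → ℤ) (h : ∀ q : ℤ, f (n - q) = f q) :
    ∑ a ∈ Finset.Icc 1 (n / 2), ((n : ℤ) - 2 * a + 1) * (f a - f (a - 1)) =
      ∑ q ∈ Finset.range (n + 1), f q - (n + 1) * f 0 := by
  -- The weight drops by 2 at each step, so summation by parts leaves twice a partial sum of `f` and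
  -- boundary terms.
  have abel : ∀ k : ℕ, ∑ a ∈ Finset.Icc 1 k, ((n : ℤ) - 2 * a + 1) * (f a - f (a - 1)) =
      (n - 2 * k - 1) * f k + 2 * ∑ q ∈ Finset.range (k + 1), f q - (n + 1) * f 0 := by
    intro k
    induction k with
    | zero => simp; ring
    | succ k ih =>
      rw [Finset.sum_Icc_succ_top (by omega), ih, Finset.sum_range_succ _ (k + 1)]
      push_cast
      rw [show (k : ℤ) + 1 - 1 = k by ring]
      ring
  rw [abel]
  -- The top `k` values on `0, …, n` mirror the bottom `k`, so twice the half sum is the full sum,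
  -- up to the middle term when `n` is even.
  have hs : ∀ k : ℕ, k ≤ n → ∑ q ∈ Finset.range k, f ((n - k : ℤ) + 1 + q) =
      ∑ q ∈ Finset.range k, f q := by
    intro k hk
    rw [← Finset.sum_range_reflect]
    refine Finset.sum_congr rfl fun q hq => ?_
    rw [Finset.mem_range] at hq
    rw [← h]
    congr 1
    omega
  obtain ⟨k, hk | hk⟩ := Nat.even_or_odd' n
  · have e : n / 2 = k := by omega
    have := hs k (by omega)
    rw [e, show n + 1 = (k + 1) + k by omega, Finset.sum_range_add _ (k + 1),
      Finset.sum_congr rfl fun (q : ℕ) _ => congrArg f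
        (show ((k + 1 + q : ℕ) : ℤ) = n - k + 1 + q by push_cast [hk]; ring),
      this, Finset.sum_range_succ, hk]
    push_cast
    ring
  · have e : n / 2 = k := by omega
    have := hs (k + 1) (by omega)
    rw [e, show n + 1 = (k + 1) + (k + 1) by omega, Finset.sum_range_add _ (k + 1),
      Finset.sum_congr rfl fun (q : ℕ) _ => congrArg f
        (show ((k + 1 + q : ℕ) : ℤ) = n - ((k + 1 : ℕ) : ℤ) + 1 + q by push_cast [hk]; ring),
      this, hk]
    push_cast
    ring

/-- The total coefficient of the Schur functions, expressed by products of complete homogeneous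
symmetric functions. -/
theorem one_add_sum_coeff (N n : ℕ) (hn : n = psum m N) :
    1 + ∑ a ∈ Finset.Icc 1 (n / 2), ((n : ℤ) - 2 * a + 1) *
        (coeffHH m N a - coeffHH m N (a - 1)) +
      ∑ a ∈ Finset.Icc 1 ((n - 1) / 2), ((n : ℤ) - 2 * a) *
        (coeffHHH m N a - coeffHHH m N (a - 1) - coeffHH m N (a + 1) + coeffHH m N (a - 1)) =
      2 + subCountErase m N - subCount m N := by
  have hsum : ∑ q ∈ Finset.range (n + 1), coeffHH m N q = subCount m N := by
    rw [hn, sum_coeffHH]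
  have hsum1 : ∑ q ∈ Finset.range n, coeffHHH m N q = subCountErase m N := by
    rw [hn, sum_coeffHHH]
  have h1 := sum_weighted_sub n (coeffHH m N) (by rw [hn]; exact coeffHH_symm m N)
  rw [hsum, coeffHH_zero] at h1
  -- Summation by parts is next applied with `n - 1`, which is a true subtraction only for positive
  -- `n`.
  obtain rfl | hpos := Nat.eq_zero_or_pos n
  · simp only [Finset.range_zero, Finset.sum_empty] at hsum1
    simp [coeffHH_zero] at hsum
    rw [← hsum1, ← hsum]
    simp
  have h2 := sum_weighted_sub (n - 1) (coeffHHH m N) (by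
    intro q
    rw [← coeffHHH_symm m N q, ← hn]
    congr 1
    omega)
  rw [show n - 1 + 1 = n by omega, hsum1, coeffHHH_zero] at h2
  have c1 : ((n - 1 : ℕ) : ℤ) = n - 1 := by omega
  have h3 : ∑ a ∈ Finset.Icc 1 ((n - 1) / 2), ((n : ℤ) - 2 * a) *
      (coeffHH m N (a + 1) - coeffHH m N (a - 1)) =
      2 * subCount m N - n - 2 - n * coeffHH m N 1 := by
    -- Split the double step into two single differences. The difference ending at `a` then collects
    -- `(n - 2a) + (n - 2a + 2)`, twice the weight of the two-row sum; the remaining terms come from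
    -- the two ends.
    have h4 : ∀ k : ℕ, ∑ a ∈ Finset.Icc 1 k, ((n : ℤ) - 2 * a) *
        (coeffHH m N (a + 1) - coeffHH m N (a - 1)) =
        2 * ∑ a ∈ Finset.Icc 1 k, ((n : ℤ) - 2 * a + 1) *
        (coeffHH m N a - coeffHH m N (a - 1)) +
        (n - 2 * k) * (coeffHH m N (k + 1) - coeffHH m N k) - n * (coeffHH m N 1 - 1) := by
      intro k
      induction k with
      | zero => simp [coeffHH_zero]
      | succ k ih =>
        rw [Finset.sum_Icc_succ_top (by omega), ih, Finset.sum_Icc_succ_top (by omega)]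
        push_cast
        rw [show (k : ℤ) + 1 - 1 = k by ring]
        ring
    -- For even `n` the upper boundary term is exactly the summand `a = n / 2` missing here; for odd
    -- `n` it vanishes by symmetry.
    obtain ⟨k, hk | hk⟩ := Nat.even_or_odd' n
    · have e : n / 2 = k - 1 + 1 := by omega
      have e' : (n - 1) / 2 = k - 1 := by omega
      have c2 : ((k - 1 : ℕ) : ℤ) = k - 1 := by omega
      have c3 : (n : ℤ) = 2 * k := by omega
      rw [e, Finset.sum_Icc_succ_top (by omega)] at h1
      rw [e', h4]
      push_cast [c2] at h1 ⊢
      rw [show (k : ℤ) - 1 + 1 = k by ring] at h1 ⊢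
      rw [c3] at h1 ⊢
      linarith
    · have e : n / 2 = k := by omega
      have e' : (n - 1) / 2 = k := by omega
      have c3 : (n : ℤ) = 2 * k + 1 := by omega
      rw [e] at h1
      have := coeffHH_symm m N k
      rw [← hn, c3, show (2 * (k : ℤ) + 1 - k) = k + 1 by ring] at this
      rw [e', h4, h1, this]
      ring
  have h5 : ∑ a ∈ Finset.Icc 1 ((n - 1) / 2), ((n : ℤ) - 2 * a) *
        (coeffHHH m N a - coeffHHH m N (a - 1) - coeffHH m N (a + 1) + coeffHH m N (a - 1)) =
      ∑ a ∈ Finset.Icc 1 ((n - 1) / 2), (((n - 1 : ℕ) : ℤ) - 2 * a + 1) *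
        (coeffHHH m N a - coeffHHH m N (a - 1)) -
      ∑ a ∈ Finset.Icc 1 ((n - 1) / 2), ((n : ℤ) - 2 * a) *
      (coeffHH m N (a + 1) - coeffHH m N (a - 1)) := by
    rw [← Finset.sum_sub_distrib]
    refine Finset.sum_congr rfl fun a _ => ?_
    rw [c1]
    ring
  rw [h5, h1, h2, h3, c1]
  ring

end StackedGrid

/-! ### Tableaux with at most three rows, and removal of the largest letter. -/

namespace StackedGrid

/-- The row lengths `p, q, r, 0, 0, …`. -/
def threeRows (p q r : ℕ) : ℕ → ℕ
  | 0 => p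
  | 1 => q
  | 2 => r
  | _ => 0

theorem threeRows_antitone {p q r : ℕ} (hpq : q ≤ p) (hqr : r ≤ q) :
    Antitone (threeRows p q r) := by
  refine antitone_nat_of_succ_le fun i => ?_
  match i with
  | 0 => exact hpq
  | 1 => exact hqr
  | 2 => exact Nat.zero_le _
  | _ + 3 => exact le_rfl

/-- `T` is a semistandard filling, with entries less than `N` and with content `m`, of the shape
with row lengths `L`, of which at most the first three are nonzero. -/
structure IsTableau (m : ℕ → ℕ) (N : ℕ) (L : ℕ → ℕ) (T : ℕ → ℕ → ℕ) : Prop where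
  zeros : ∀ i j, L i ≤ j → T i j = 0
  row_weak : ∀ i j₁ j₂, j₁ ≤ j₂ → j₂ < L i → T i j₁ ≤ T i j₂
  col_strict : ∀ i₁ i₂ j, i₁ < i₂ → j < L i₂ → T i₁ j < T i₂ j
  lt : ∀ i j, j < L i → T i j < N
  content : ∀ k < N, ∑ i ∈ Finset.range 3, ((Finset.range (L i)).filter (T i · = k)).card = m k

theorem psum_eq_sum (m : ℕ → ℕ) (N : ℕ) : psum m N = ∑ k ∈ Finset.range N, m k := by
  induction N with
  | zero => rfl
  | succ N ih => rw [psum, ih, Finset.sum_range_succ]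

theorem IsTableau.sum_eq {m : ℕ → ℕ} {N : ℕ} {L : ℕ → ℕ} {T : ℕ → ℕ → ℕ}
    (h : IsTableau m N L T) : ∑ i ∈ Finset.range 3, L i = psum m N := by
  rw [psum_eq_sum, ← Finset.sum_congr rfl fun k hk => h.content k (Finset.mem_range.1 hk),
    Finset.sum_comm]
  refine Finset.sum_congr rfl fun i _ => ?_
  rw [← Finset.card_eq_sum_card_fiberwise, Finset.card_range]
  intro j hj
  simp only [Finset.coe_range, Set.mem_Iio] at hj ⊢
  exact h.lt i j hj

/-- A downward closed part of an initial segment is the initial segment of its cardinality. -/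
theorem mem_iff_lt_card_filter (n : ℕ) (P : ℕ → Prop) [DecidablePred P]
    (hP : ∀ j₁ j₂, j₁ ≤ j₂ → j₂ < n → P j₂ → P j₁) (j : ℕ) (hj : j < n) :
    P j ↔ j < ((Finset.range n).filter P).card := by
  constructor
  · intro h
    have : Finset.range (j + 1) ⊆ (Finset.range n).filter P := by
      intro x hx
      simp only [Finset.mem_range, Finset.mem_filter] at hx ⊢
      exact ⟨by omega, hP x j (by omega) hj h⟩
    simpa using Finset.card_le_card this
  · intro h
    by_contra hn
    have : (Finset.range n).filter P ⊆ Finset.range j := by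
      intro x hx
      simp only [Finset.mem_range, Finset.mem_filter] at hx ⊢
      by_contra hx'
      exact hn (hP j x (by omega) hx.1 hx.2)
    have := Finset.card_le_card this
    simp only [Finset.card_range] at this
    omega

/-- The fillings of the shape `L` whose entries less than `N` fill the shape `S`. -/
def HasCore (N : ℕ) (L S : ℕ → ℕ) (T : ℕ → ℕ → ℕ) : Prop :=
  ∀ i j, j < L i → (T i j < N ↔ j < S i)

theorem IsTableau.restrict {m : ℕ → ℕ} {N : ℕ} {L S : ℕ → ℕ} {T : ℕ → ℕ → ℕ}
    (h : IsTableau m (N + 1) L T) (hS : HasCore N L S T) (hle : ∀ i, S i ≤ L i) :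
    IsTableau m N S (fun i j => if j < S i then T i j else 0) where
  zeros i j hj := if_neg (by omega)
  row_weak i j₁ j₂ h₁ h₂ := by
    rw [if_pos (h₁.trans_lt h₂), if_pos h₂]
    exact h.row_weak i j₁ j₂ h₁ (h₂.trans_le (hle i))
  col_strict i₁ i₂ j hi hj := by
    have hc := h.col_strict i₁ i₂ j hi (hj.trans_le (hle _))
    rw [if_pos hj]
    split_ifs with h'
    · exact hc
    · exact (Nat.zero_le _).trans_lt hc
  lt i j hj := by
    rw [if_pos hj]
    exact (hS i j (hj.trans_le (hle i))).2 hj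
  content k hk := by
    rw [← h.content k (by omega)]
    refine Finset.sum_congr rfl fun i _ => congrArg Finset.card ?_
    ext j
    simp only [Finset.mem_filter, Finset.mem_range]
    constructor
    · rintro ⟨h₁, h₂⟩
      rw [if_pos h₁] at h₂
      exact ⟨h₁.trans_le (hle i), h₂⟩
    · rintro ⟨h₁, h₂⟩
      have := (hS i j h₁).1 (by omega)
      rw [if_pos this]
      exact ⟨this, h₂⟩

/-- The interlacing `hint` makes the new cells a horizontal strip, so columns stay strict when all
of them receive the letter `N`. -/
theorem IsTableau.extend {m : ℕ → ℕ} {N : ℕ} {L S : ℕ → ℕ} {T : ℕ → ℕ → ℕ}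
    (h : IsTableau m N S T) (hle : ∀ i, S i ≤ L i) (hint : ∀ i, L (i + 1) ≤ S i)
    (hsum : ∑ i ∈ Finset.range 3, L i = psum m (N + 1)) :
    IsTableau m (N + 1) L
      (fun i j => if j < S i then T i j else if j < L i then N else 0) where
  zeros i j hj := by
    have := hle i
    rw [if_neg (by omega), if_neg (by omega)]
  row_weak i j₁ j₂ h₁ h₂ := by
    rw [if_pos (h₁.trans_lt h₂)]
    split_ifs with h₃ h₄ h₄
    · exact h.row_weak i j₁ j₂ h₁ h₄
    · exact (h.lt _ _ h₃).le
    · omega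
    · exact le_rfl
  col_strict i₁ i₂ j hi hj := by
    have hS : Antitone S := antitone_nat_of_succ_le fun i => (hle _).trans (hint i)
    have h₁ : j < S i₁ := by
      obtain ⟨d, rfl⟩ := Nat.exists_eq_add_of_lt hi
      have h₂ := hint (i₁ + d)
      have h₃ := hS (Nat.le_add_right i₁ d)
      omega
    rw [if_pos h₁, if_pos hj]
    split_ifs with h₂
    · exact h.col_strict i₁ i₂ j hi h₂
    · exact h.lt _ _ h₁
  lt i j hj := by
    rw [if_pos hj]
    split_ifs with h₁
    · exact (h.lt _ _ h₁).trans (Nat.lt_succ_self _)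
    · exact Nat.lt_succ_self _
  content k hk := by
    obtain hk | rfl := Nat.lt_succ_iff_lt_or_eq.1 hk
    · rw [← h.content k hk]
      refine Finset.sum_congr rfl fun i _ => congrArg Finset.card ?_
      ext j
      simp only [Finset.mem_filter, Finset.mem_range]
      constructor
      · rintro ⟨h₁, h₂⟩
        rw [if_pos h₁] at h₂
        split_ifs at h₂ with h₃
        · exact ⟨h₃, h₂⟩
        · omega
      · rintro ⟨h₁, h₂⟩
        rw [if_pos h₁]
        exact ⟨h₁.trans_le (hle i), h₂⟩
    -- The multiplicity of the new letter is forced by the sizes: it is the number of cells of `L`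
    -- outside `S`.
    · have hs := h.sum_eq
      have : ∀ i, ((Finset.range (L i)).filter
          (fun j => (if j < S i then T i j else if j < L i then k else 0) = k)).card + S i =
          L i := by
        intro i
        rw [show (Finset.range (L i)).filter
          (fun j => (if j < S i then T i j else if j < L i then k else 0) = k) =
          Finset.Ico (S i) (L i) from ?_, Nat.card_Ico]
        · have := hle i
          omega
        · ext j
          simp only [Finset.mem_filter, Finset.mem_range, Finset.mem_Ico]
          constructor
          · rintro ⟨h₁, h₂⟩
            refine ⟨?_, h₁⟩
            by_contra h₃
            rw [if_pos (by omega)] at h₂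
            have := h.lt i j (by omega)
            omega
          · rintro ⟨h₁, h₂⟩
            rw [if_neg (by omega), if_pos h₂]
            exact ⟨h₂, rfl⟩
      rw [psum, ← hs, ← Finset.sum_congr rfl fun i _ => this i, Finset.sum_add_distrib] at hsum
      omega

/-- The fillings with a prescribed core are the fillings of the core. -/
def coreEquiv {m : ℕ → ℕ} {N : ℕ} {L S : ℕ → ℕ} (hle : ∀ i, S i ≤ L i)
    (hint : ∀ i, L (i + 1) ≤ S i) (hsum : ∑ i ∈ Finset.range 3, L i = psum m (N + 1)) :
    {T // IsTableau m (N + 1) L T ∧ HasCore N L S T} ≃ {T // IsTableau m N S T} where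
  toFun T := ⟨_, T.2.1.restrict T.2.2 hle⟩
  invFun T := ⟨_, T.2.extend hle hint hsum, by
    intro i j hj
    dsimp only
    rw [if_pos hj]
    split_ifs with h
    · simpa [h] using T.2.lt i j h
    · simp [h]⟩
  left_inv T := by
    ext i j
    dsimp only
    split_ifs with h₁ h₂
    · rfl
    · have h₃ := (T.2.2 i j h₂).not.2 h₁
      have h₄ := T.2.1.lt i j h₂
      omega
    · exact (T.2.1.zeros i j (by omega)).symm
  right_inv T := by
    ext i j
    dsimp only
    split_ifs with h₁
    · rfl
    · exact (T.2.zeros i j (by omega)).symm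

/-- The pairs of a second and a third row length of the shapes of size `M` that arise from the
shape `p, q, r` by removing a horizontal strip. -/
def innerShapes (M p q r : ℕ) : Finset (ℕ × ℕ) :=
  (Finset.range (q + 1) ×ˢ Finset.range (r + 1)).filter fun x =>
    r ≤ x.1 ∧ x.1 + x.2 ≤ M ∧ q ≤ M - x.1 - x.2 ∧ M - x.1 - x.2 ≤ p

/-- Rows increase weakly, so the entries below `N` form initial segments of the rows. Strict columns
force interlacing: otherwise the cell just past the core in row `i` would hold at least `N`, and the
cell below it more than `N`. -/
theorem IsTableau.exists_core {m : ℕ → ℕ} {N p q r : ℕ} {T : ℕ → ℕ → ℕ} (hpq : q ≤ p)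
    (hqr : r ≤ q) (h : IsTableau m (N + 1) (threeRows p q r) T) :
    ∃ x ∈ innerShapes (psum m N) p q r,
      HasCore N (threeRows p q r) (threeRows (psum m N - x.1 - x.2) x.1 x.2) T := by
  set L := threeRows p q r with hL
  let S : ℕ → ℕ := fun i => ((Finset.range (L i)).filter (T i · < N)).card
  have hS : HasCore N L S T := fun i j hj => mem_iff_lt_card_filter _ (T i · < N)
    (fun j₁ j₂ h₁ h₂ h₃ => (h.row_weak i j₁ j₂ h₁ h₂).trans_lt h₃) j hj
  have hle : ∀ i, S i ≤ L i := fun i => (Finset.card_filter_le _ _).trans (by simp)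
  have hsum := (h.restrict hS hle).sum_eq
  have hint : ∀ i, L (i + 1) ≤ S i := by
    intro i
    by_contra! hlt
    have h₁ := h.col_strict i (i + 1) (S i) (by omega) hlt
    have h₂ := h.lt (i + 1) _ hlt
    have h₃ := (hS i (S i) (hlt.trans_le (threeRows_antitone hpq hqr (Nat.le_succ i)))).not.2
      (lt_irrefl _)
    omega
  have h0 := hint 0
  have h1 := hint 1
  have h0' := hle 0
  have h1' := hle 1
  have h2' := hle 2
  simp only [Finset.sum_range_succ, Finset.sum_range_zero, zero_add] at hsum
  have e0 : L 0 = p := rfl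
  have e1 : L 1 = q := rfl
  have e2 : L 2 = r := rfl
  rw [zero_add, e1] at h0
  rw [show 1 + 1 = 2 from rfl, e2] at h1
  rw [e0] at h0'
  rw [e1] at h1'
  rw [e2] at h2'
  refine ⟨(S 1, S 2), ?_, ?_⟩
  · simp only [innerShapes, Finset.mem_filter, Finset.mem_product, Finset.mem_range]
    omega
  · have : threeRows (psum m N - S 1 - S 2) (S 1) (S 2) = S := by
      funext i
      match i with
      | 0 => simp only [threeRows]; omega
      | 1 => rfl
      | 2 => rfl
      | i + 3 => exact (Nat.le_zero.1 (hle (i + 3))).symm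
    simpa only [this] using hS

/-- The number of tableaux of shape `p, q, r` and content `m`. -/
noncomputable def tableauCount (m : ℕ → ℕ) (N p q r : ℕ) : ℕ :=
  Nat.card {T // IsTableau m N (threeRows p q r) T}

theorem HasCore.eq_of_innerShapes {N M p q r : ℕ} {T : ℕ → ℕ → ℕ} {x y : ℕ × ℕ}
    (hx : x ∈ innerShapes M p q r) (hy : y ∈ innerShapes M p q r)
    (hTx : HasCore N (threeRows p q r) (threeRows (M - x.1 - x.2) x.1 x.2) T)
    (hTy : HasCore N (threeRows p q r) (threeRows (M - y.1 - y.2) y.1 y.2) T) : x = y := by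
  simp only [innerShapes, Finset.mem_filter, Finset.mem_product, Finset.mem_range] at hx hy
  have key : ∀ a b c : ℕ, a ≤ c → b ≤ c → (∀ j < c, j < a ↔ j < b) → a = b := by
    intro a b c ha hb h
    have h₁ := h a
    have h₂ := h b
    omega
  exact Prod.ext
    (key _ _ q (by omega) (by omega) fun j hj => (hTx 1 j hj).symm.trans (hTy 1 j hj))
    (key _ _ r (by omega) (by omega) fun j hj => (hTx 2 j hj).symm.trans (hTy 2 j hj))

theorem innerShapes_interlace {M p q r : ℕ} {x : ℕ × ℕ} (hx : x ∈ innerShapes M p q r) :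
    (∀ i, threeRows (M - x.1 - x.2) x.1 x.2 i ≤ threeRows p q r i) ∧
      ∀ i, threeRows p q r (i + 1) ≤ threeRows (M - x.1 - x.2) x.1 x.2 i := by
  simp only [innerShapes, Finset.mem_filter, Finset.mem_product, Finset.mem_range] at hx
  constructor <;> intro i
  · match i with
    | 0 => exact hx.2.2.2.2
    | 1 => exact Nat.lt_succ_iff.1 hx.1.1
    | 2 => exact Nat.lt_succ_iff.1 hx.1.2
    | _ + 3 => exact le_rfl
  · match i with
    | 0 => exact hx.2.2.2.1
    | 1 => exact hx.2.1
    | 2 => exact Nat.zero_le _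
    | _ + 3 => exact le_rfl

open Classical in
/-- The tableaux of a shape correspond to the tableaux of the possible cores. -/
noncomputable def tableauEquiv {m : ℕ → ℕ} {N p q r : ℕ} (hpq : q ≤ p) (hqr : r ≤ q)
    (hsum : p + q + r = psum m (N + 1)) :
    {T // IsTableau m (N + 1) (threeRows p q r) T} ≃
      Σ x : {x // x ∈ innerShapes (psum m N) p q r},
        {T // IsTableau m N (threeRows (psum m N - x.1.1 - x.1.2) x.1.1 x.1.2) T} :=
  let core (T : {T // IsTableau m (N + 1) (threeRows p q r) T}) :
      {x // x ∈ innerShapes (psum m N) p q r} :=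
    ⟨_, (T.2.exists_core hpq hqr).choose_spec.1⟩
  have core_iff (T) (x : {x // x ∈ innerShapes (psum m N) p q r}) : core T = x ↔
      HasCore N (threeRows p q r) (threeRows (psum m N - x.1.1 - x.1.2) x.1.1 x.1.2) T.1 := by
    have h := (T.2.exists_core hpq hqr).choose_spec.2
    constructor
    · rintro rfl
      exact h
    · intro h'
      exact Subtype.ext (HasCore.eq_of_innerShapes (core T).2 x.2 h h')
  (Equiv.sigmaFiberEquiv core).symm.trans <| Equiv.sigmaCongrRight fun x =>
    ((Equiv.subtypeEquivRight fun T => core_iff T x).trans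
      (Equiv.subtypeSubtypeEquivSubtypeInter (IsTableau m (N + 1) (threeRows p q r))
        (HasCore N (threeRows p q r) (threeRows (psum m N - x.1.1 - x.1.2) x.1.1 x.1.2)))).trans
      (coreEquiv (innerShapes_interlace x.2).1 (innerShapes_interlace x.2).2
        (by simpa [Finset.sum_range_succ, threeRows] using hsum))

theorem isTableau_zero_iff {m : ℕ → ℕ} {p q r : ℕ} {T : ℕ → ℕ → ℕ} :
    IsTableau m 0 (threeRows p q r) T ↔ (p = 0 ∧ q = 0 ∧ r = 0) ∧ T = 0 := by
  constructor
  · intro h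
    have hs := h.sum_eq
    simp only [Finset.sum_range_succ, Finset.sum_range_zero, threeRows, psum] at hs
    obtain ⟨rfl, rfl, rfl⟩ : p = 0 ∧ q = 0 ∧ r = 0 := by omega
    refine ⟨⟨rfl, rfl, rfl⟩, ?_⟩
    funext i j
    refine h.zeros i j ?_
    match i with
    | 0 => exact Nat.zero_le _
    | 1 => exact Nat.zero_le _
    | 2 => exact Nat.zero_le _
    | _ + 3 => exact Nat.zero_le _
  · rintro ⟨⟨rfl, rfl, rfl⟩, rfl⟩
    have h : ∀ i, threeRows 0 0 0 i = 0 := fun i =>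
      match i with
      | 0 => rfl
      | 1 => rfl
      | 2 => rfl
      | _ + 3 => rfl
    exact ⟨fun _ _ _ => rfl, fun _ _ _ _ _ => le_rfl,
      fun i₁ i₂ j _ hj => absurd hj (by simp [h]), fun i j hj => absurd hj (by simp [h]),
      fun k hk => absurd hk (Nat.not_lt_zero _)⟩

theorem finite_tableau (m : ℕ → ℕ) (N p q r : ℕ) (hpq : q ≤ p) (hqr : r ≤ q) :
    Finite {T // IsTableau m N (threeRows p q r) T} := by
  induction N generalizing p q r with
  | zero =>
    have : Subsingleton {T // IsTableau m 0 (threeRows p q r) T} :=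
      ⟨fun S T => Subtype.ext
        ((isTableau_zero_iff.1 S.2).2.trans (isTableau_zero_iff.1 T.2).2.symm)⟩
    infer_instance
  | succ N ih =>
    by_cases hsum : p + q + r = psum m (N + 1)
    · have : ∀ x : {x // x ∈ innerShapes (psum m N) p q r},
          Finite {T // IsTableau m N (threeRows (psum m N - x.1.1 - x.1.2) x.1.1 x.1.2) T} := by
        rintro ⟨x, hx⟩
        simp only [innerShapes, Finset.mem_filter, Finset.mem_product, Finset.mem_range] at hx
        exact ih _ _ _ (by dsimp only; omega) (by dsimp only; omega)
      exact Finite.of_equiv _ (tableauEquiv hpq hqr hsum).symm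
    · have : IsEmpty {T // IsTableau m (N + 1) (threeRows p q r) T} := ⟨fun T => hsum (by
        simpa [Finset.sum_range_succ, threeRows] using T.2.sum_eq)⟩
      infer_instance

theorem tableauCount_succ {m : ℕ → ℕ} {N p q r : ℕ} (hpq : q ≤ p) (hqr : r ≤ q)
    (hsum : p + q + r = psum m (N + 1)) :
    tableauCount m (N + 1) p q r = ∑ x ∈ innerShapes (psum m N) p q r,
      tableauCount m N (psum m N - x.1 - x.2) x.1 x.2 := by
  have : ∀ x : {x // x ∈ innerShapes (psum m N) p q r},
      Finite {T // IsTableau m N (threeRows (psum m N - x.1.1 - x.1.2) x.1.1 x.1.2) T} := by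
    rintro ⟨x, hx⟩
    simp only [innerShapes, Finset.mem_filter, Finset.mem_product, Finset.mem_range] at hx
    exact finite_tableau _ _ _ _ _ (by dsimp only; omega) (by dsimp only; omega)
  rw [tableauCount, Nat.card_congr (tableauEquiv hpq hqr hsum), Nat.card_sigma]
  exact Finset.sum_coe_sort (innerShapes (psum m N) p q r) fun x =>
    tableauCount m N (psum m N - x.1 - x.2) x.1 x.2

/-! ### Kostka numbers of the shapes `(p, q)` and `(p, q, 1)`. -/

theorem sum_Ico_sub_pred (F : ℤ → ℤ) (a b : ℕ) (hab : a ≤ b) :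
    ∑ x ∈ Finset.Ico a b, (F x - F (x - 1)) = F (b - 1) - F (a - 1) := by
  induction b, hab using Nat.le_induction with
  | base => simp
  | succ b hb ih =>
    rw [Finset.sum_Ico_succ_top hb, ih]
    push_cast
    rw [show (b : ℤ) + 1 - 1 = b by ring]
    ring

/-- This is `s_{p,q} = h_p h_q - h_{p+1} h_{q-1}` on coefficients. The possible cores have second
rows in an interval, so the induction hypothesis telescopes to the recursion `coeffHH_succ_sub`. -/
theorem tableauCount_two_rows (m : ℕ → ℕ) (N p q : ℕ) (hpq : q ≤ p) (hsum : p + q = psum m N) :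
    (tableauCount m N p q 0 : ℤ) = coeffHH m N q - coeffHH m N (q - 1) := by
  induction N generalizing p q with
  | zero =>
    simp only [psum] at hsum
    obtain rfl : p = 0 := by omega
    obtain rfl : q = 0 := by omega
    simp [tableauCount, isTableau_zero_iff, coeffHH]
  | succ N ih =>
    rw [tableauCount_succ hpq (Nat.zero_le _) hsum, coeffHH_succ_sub]
    simp only [psum] at hsum
    push_cast
    by_cases hM : q ≤ psum m N
    · have hset : innerShapes (psum m N) p q 0 =
          Finset.Ico (q - m N) (min q (psum m N - q) + 1) ×ˢ {0} := by
        ext ⟨x, y⟩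
        simp only [innerShapes, Finset.mem_filter, Finset.mem_product, Finset.mem_range,
          Finset.mem_Ico, Finset.mem_singleton]
        omega
      have e : ∀ x ∈ Finset.Ico (q - m N) (min q (psum m N - q) + 1),
          (tableauCount m N (psum m N - x - 0) x 0 : ℤ) =
            coeffHH m N x - coeffHH m N (x - 1) := by
        intro x hx
        rw [Finset.mem_Ico] at hx
        exact ih _ _ (by omega) (by omega)
      simp only [hset, Finset.sum_product, Finset.sum_singleton]
      rw [Finset.sum_congr rfl e, sum_Ico_sub_pred]
      · have h₁ : coeffHH m N ((min q (psum m N - q) + 1 : ℕ) - 1) = coeffHH m N q := by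
          rcases min_choice q (psum m N - q) with h | h <;> rw [h]
          · simp
          · rw [← coeffHH_symm]
            congr 1
            omega
        -- When the natural subtraction truncates, both arguments are negative and both values are
        -- zero.
        have h₂ : coeffHH m N ((q - m N : ℕ) - 1) = coeffHH m N (q - m N - 1) := by
          by_cases h : m N ≤ q
          · rw [Nat.cast_sub h]
          · rw [coeffHH_of_neg _ _ _ (by omega), coeffHH_of_neg _ _ _ (by omega)]
        rw [h₁, h₂]
      · omega
    · rw [coeffHH_of_gt _ _ _ (by omega), coeffHH_of_neg _ _ _ (by omega), sub_zero]
      refine Finset.sum_eq_zero fun x hx => ?_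
      simp only [innerShapes, Finset.mem_filter, Finset.mem_product, Finset.mem_range] at hx
      omega

/-- This is the Jacobi–Trudi expansion `s_{p,q,1} = h_1 h_p h_q - h_1 h_{p+1} h_{q-1} - h_p h_{q+1}
+ h_{p+2} h_{q-1}`, proved by the same telescoping over cores. -/
theorem tableauCount_three_rows (m : ℕ → ℕ) (N p q : ℕ) (hpq : q ≤ p) (hq : 1 ≤ q)
    (hsum : p + q + 1 = psum m N) :
    (tableauCount m N p q 1 : ℤ) = coeffHHH m N q - coeffHHH m N (q - 1) -
      coeffHH m N (q + 1) + coeffHH m N (q - 1) := by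
  induction N generalizing p q with
  | zero => simp [psum] at hsum
  | succ N ih =>
    have hrec : coeffHHH m (N + 1) q - coeffHHH m (N + 1) (q - 1) -
        coeffHH m (N + 1) (q + 1) + coeffHH m (N + 1) (q - 1) =
        coeffHHH m N q - coeffHH m N (q + 1) - coeffHHH m N (q - m N - 1) +
          coeffHH m N (q - m N - 1) := by
      have h₁ := coeffHHH_succ_sub m N q
      have h₂ := coeffHH_succ_sub m N q
      have h₃ := coeffHH_succ_sub m N (q + 1)
      rw [show (q : ℤ) + 1 - m N - 1 = q - m N by ring, add_sub_cancel_right] at h₃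
      linarith
    rw [tableauCount_succ hpq hq hsum, hrec]
    simp only [psum] at hsum
    push_cast
    by_cases hM : q + 1 ≤ psum m N
    -- The cores split by whether the single cell of the third row survives. In both cases the
    -- second row keeps at least one cell, the one above it.
    · have hset : innerShapes (psum m N) p q 1 =
          Finset.Ico (max 1 (q - m N)) (min q (psum m N - q - 1) + 1) ×ˢ {1} ∪
          Finset.Ico (max 1 (q + 1 - m N)) (min q (psum m N - q) + 1) ×ˢ {0} := by
        ext ⟨x, y⟩
        simp only [innerShapes, Finset.mem_filter, Finset.mem_product, Finset.mem_range,
          Finset.mem_Ico, Finset.mem_singleton, Finset.mem_union]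
        omega
      rw [hset, Finset.sum_union]
      · have e₁ : ∀ x ∈ Finset.Ico (max 1 (q - m N)) (min q (psum m N - q - 1) + 1),
            (tableauCount m N (psum m N - x - 1) x 1 : ℤ) =
              (fun z : ℤ => coeffHHH m N z - coeffHH m N (z + 1) - coeffHH m N z) x -
              (fun z : ℤ => coeffHHH m N z - coeffHH m N (z + 1) - coeffHH m N z) (x - 1) := by
          intro x hx
          rw [Finset.mem_Ico] at hx
          rw [ih _ _ (by omega) (by omega) (by omega)]
          dsimp only
          rw [sub_add_cancel]
          ring
        have e₂ : ∀ x ∈ Finset.Ico (max 1 (q + 1 - m N)) (min q (psum m N - q) + 1),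
            (tableauCount m N (psum m N - x - 0) x 0 : ℤ) =
              coeffHH m N x - coeffHH m N (x - 1) := by
          intro x hx
          rw [Finset.mem_Ico] at hx
          exact tableauCount_two_rows _ _ _ _ (by omega) (by omega)
        simp only [Finset.sum_product, Finset.sum_singleton]
        rw [Finset.sum_congr rfl e₁, Finset.sum_congr rfl e₂,
          sum_Ico_sub_pred (fun z : ℤ => coeffHHH m N z - coeffHH m N (z + 1) - coeffHH m N z) _ _
            (by omega), sum_Ico_sub_pred _ _ _ (by omega)]
        rw [sub_add_cancel, sub_add_cancel]
        have h₁ : coeffHH m N ((min q (psum m N - q) + 1 : ℕ) - 1) = coeffHH m N q := by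
          rcases min_choice q (psum m N - q) with h | h <;> rw [h]
          · simp
          · rw [← coeffHH_symm]
            congr 1
            omega
        have h₂ : coeffHHH m N ((min q (psum m N - q - 1) + 1 : ℕ) - 1) = coeffHHH m N q := by
          rcases min_choice q (psum m N - q - 1) with h | h <;> rw [h]
          · simp
          · rw [← coeffHHH_symm]
            congr 1
            omega
        -- Only the sum of these two neighbouring values is determined: at the other end of the
        -- `min`, reflection exchanges them.
        have h₃ : coeffHH m N (min q (psum m N - q - 1) + 1 : ℕ) +
            coeffHH m N ((min q (psum m N - q - 1) + 1 : ℕ) - 1) =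
            coeffHH m N (q + 1) + coeffHH m N q := by
          rcases min_choice q (psum m N - q - 1) with h | h <;> rw [h]
          · simp
          · rw [add_comm, ← coeffHH_symm, ← coeffHH_symm m N (psum m N - q - 1 + 1 : ℕ)]
            congr 2 <;> omega
        by_cases hqm : m N < q
        · rw [max_eq_right (by omega), max_eq_right (by omega)]
          rw [Nat.cast_sub (by omega), Nat.cast_sub (by omega)]
          push_cast at h₁ h₂ h₃ ⊢
          rw [show (q : ℤ) + 1 - m N - 1 = q - m N by ring]
          linarith
        -- Both intervals start at 1; their lower boundary terms at 0 cancel because `coeffHHH m N 0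
        -- = coeffHH m N 1`.
        · rw [max_eq_left (by omega), max_eq_left (by omega),
            coeffHHH_of_neg _ _ _ (show (q : ℤ) - m N - 1 < 0 by omega),
            coeffHH_of_neg _ _ _ (show (q : ℤ) - m N - 1 < 0 by omega)]
          push_cast at h₁ h₂ h₃ ⊢
          rw [coeffHHH_zero]
          linarith
      · rw [Finset.disjoint_left]
        simp only [Finset.mem_product, Finset.mem_singleton]
        omega
    · rw [coeffHHH_of_gt _ _ _ (by omega), coeffHH_of_gt _ _ _ (by omega),
        coeffHHH_of_neg _ _ _ (by omega), coeffHH_of_neg _ _ _ (by omega)]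
      refine (Finset.sum_eq_zero fun x hx => ?_).trans (by ring)
      simp only [innerShapes, Finset.mem_filter, Finset.mem_product, Finset.mem_range] at hx
      omega

end StackedGrid

/-! ### Coefficients and positivity of the Schur expansion. -/

namespace StackedGrid

/-- Semistandard Young tableaux with content `f` are the fillings of `IsTableau`. -/
def tableauEquivSSYT {μ : YoungDiagram} {p q r N : ℕ}
    (hμ : ∀ i j, (i, j) ∈ μ ↔ j < threeRows p q r i) (f : ℕ →₀ ℕ) (hf : ∀ k, N ≤ k → f k = 0) :
    {T : SemistandardYoungTableau μ // ∑ c ∈ μ.cells, Finsupp.single (T c.1 c.2) 1 = f} ≃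
      {T // IsTableau f N (threeRows p q r) T} :=
  have hc (T : ℕ → ℕ → ℕ) (k : ℕ) : (∑ c ∈ μ.cells, Finsupp.single (T c.1 c.2) 1 : ℕ →₀ ℕ) k =
      ∑ i ∈ Finset.range 3, ((Finset.range (threeRows p q r i)).filter (T i · = k)).card := by
    rw [Finset.sum_finset_product μ.cells (Finset.range 3)
      (fun i => Finset.range (threeRows p q r i))]
    · simp [Finsupp.single_apply]
    · rintro ⟨i, j⟩
      simp only [YoungDiagram.mem_cells, hμ, Finset.mem_range]
      constructor
      · intro h
        refine ⟨?_, h⟩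
        by_contra hi
        obtain ⟨d, rfl⟩ := Nat.exists_eq_add_of_le (not_lt.1 hi)
        rw [add_comm] at h
        exact Nat.not_lt_zero _ h
      · exact fun h => h.2
  have hlt (T : ℕ → ℕ → ℕ) (hT : (∑ c ∈ μ.cells, Finsupp.single (T c.1 c.2) 1 : ℕ →₀ ℕ) = f)
      (i j : ℕ) (hj : j < threeRows p q r i) : T i j < N := by
    by_contra! h
    have h₁ := hf _ h
    rw [← hT, Finsupp.finsetSum_apply, Finset.sum_eq_zero_iff] at h₁
    simpa using h₁ (i, j) ((hμ i j).2 hj)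
  { toFun T := ⟨T.1,
      { zeros i j h := T.1.zeros (by rw [hμ]; omega)
        row_weak i j₁ j₂ h h' := T.1.row_weak_of_le h ((hμ _ _).2 h')
        col_strict i₁ i₂ j h h' := T.1.col_strict h ((hμ _ _).2 h')
        lt := hlt _ T.2
        content k _ := by rw [← hc, T.2] }⟩
    invFun T := ⟨
      { entry := T.1
        row_weak' h h' := T.2.row_weak _ _ _ h.le ((hμ _ _).1 h')
        col_strict' h h' := T.2.col_strict _ _ _ h ((hμ _ _).1 h')
        zeros' h := T.2.zeros _ _ (by rw [hμ] at h; omega) }, by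
      ext k
      refine (hc T.1 k).trans ?_
      by_cases hk : k < N
      · exact T.2.content k hk
      · rw [hf k (by omega)]
        refine Finset.sum_eq_zero fun i _ => ?_
        rw [Finset.card_eq_zero, Finset.filter_eq_empty_iff]
        intro j hj h
        have := T.2.lt i j (Finset.mem_range.1 hj)
        omega⟩
    left_inv _ := rfl
    right_inv _ := rfl }

theorem coeff_schur {μ : YoungDiagram} {p q r N : ℕ}
    (hμ : ∀ i j, (i, j) ∈ μ ↔ j < threeRows p q r i) (f : ℕ →₀ ℕ) (hf : ∀ k, N ≤ k → f k = 0) :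
    MvPowerSeries.coeff f (schur μ) = tableauCount f N p q r :=
  congrArg Nat.cast (Nat.card_congr (tableauEquivSSYT hμ f hf))

theorem schurOfRows_eq {w : List ℕ} (hw : w.SortedGE) :
    schurOfRows w = schur (YoungDiagram.ofRowLens w hw) :=
  dif_pos hw

theorem mem_ofRowLens_one {p : ℕ} (hw : [p].SortedGE) (i j : ℕ) :
    (i, j) ∈ YoungDiagram.ofRowLens [p] hw ↔ j < threeRows p 0 0 i := by
  rw [YoungDiagram.mem_ofRowLens]
  match i with
  | 0 => simp [threeRows]
  | 1 => simp [threeRows]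
  | 2 => simp [threeRows]
  | _ + 3 => simp [threeRows]

theorem mem_ofRowLens_two {p q : ℕ} (hw : [p, q].SortedGE) (i j : ℕ) :
    (i, j) ∈ YoungDiagram.ofRowLens [p, q] hw ↔ j < threeRows p q 0 i := by
  rw [YoungDiagram.mem_ofRowLens]
  match i with
  | 0 => simp [threeRows]
  | 1 => simp [threeRows]
  | 2 => simp [threeRows]
  | _ + 3 => simp [threeRows]

theorem mem_ofRowLens_three {p q r : ℕ} (hw : [p, q, r].SortedGE) (i j : ℕ) :
    (i, j) ∈ YoungDiagram.ofRowLens [p, q, r] hw ↔ j < threeRows p q r i := by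
  rw [YoungDiagram.mem_ofRowLens]
  match i with
  | 0 => simp [threeRows]
  | 1 => simp [threeRows]
  | 2 => simp [threeRows]
  | _ + 3 => simp [threeRows]

theorem sortedGE_one (p : ℕ) : [p].SortedGE := by
  simp [List.sortedGE_iff_pairwise]

theorem sortedGE_two {p q : ℕ} (hpq : q ≤ p) : [p, q].SortedGE := by
  simpa [List.sortedGE_iff_pairwise] using hpq

theorem sortedGE_three {p q r : ℕ} (hpq : q ≤ p) (hqr : r ≤ q) : [p, q, r].SortedGE := by
  simp [List.sortedGE_iff_pairwise]
  omega

theorem card_of_mem_iff {μ : YoungDiagram} {p q r : ℕ}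
    (hμ : ∀ i j, (i, j) ∈ μ ↔ j < threeRows p q r i) : μ.card = p + q + r := by
  rw [YoungDiagram.card, Finset.card_eq_sum_ones, Finset.sum_finset_product μ.cells
    (Finset.range 3) (fun i => Finset.range (threeRows p q r i))]
  · simp [Finset.sum_range_succ, threeRows]
  · rintro ⟨i, j⟩
    simp only [YoungDiagram.mem_cells, hμ, Finset.mem_range]
    constructor
    · intro h
      refine ⟨?_, h⟩
      by_contra hi
      obtain ⟨d, rfl⟩ := Nat.exists_eq_add_of_le (not_lt.1 hi)
      rw [add_comm] at h
      exact Nat.not_lt_zero _ h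
    · exact fun h => h.2

theorem tableauCount_eq_zero {m : ℕ → ℕ} {N p q r : ℕ} (h : p + q + r ≠ psum m N) :
    tableauCount m N p q r = 0 := by
  have : IsEmpty {T // IsTableau m N (threeRows p q r) T} := ⟨fun T => h (by
    simpa [Finset.sum_range_succ, threeRows] using T.2.sum_eq)⟩
  exact Nat.card_of_isEmpty

/-- The Schur expansion of the generating function of the stacked grid class. -/
noncomputable def schurSide (n : ℕ) : MvPowerSeries ℕ ℚ :=
  schurOfRows [n]
    + ∑ a ∈ Finset.Icc 1 (n / 2), ((n : ℚ) - 2 * (a : ℚ) + 1) • schurOfRows [n - a, a]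
    + ∑ a ∈ Finset.Icc 1 ((n - 1) / 2), ((n : ℚ) - 2 * (a : ℚ)) • schurOfRows [n - a - 1, a, 1]

theorem coeff_schurSide (n N : ℕ) (f : ℕ →₀ ℕ) (hf : ∀ k, N ≤ k → f k = 0) :
    MvPowerSeries.coeff f (schurSide n) =
      if psum f N = n then ((2 + subCountErase f N - subCount f N : ℤ) : ℚ) else 0 := by
  have h₁ : MvPowerSeries.coeff f (schurOfRows [n]) = tableauCount f N n 0 0 := by
    rw [schurOfRows_eq (sortedGE_one n), coeff_schur (mem_ofRowLens_one _) f hf]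
  have h₂ : ∀ a ∈ Finset.Icc 1 (n / 2), MvPowerSeries.coeff f
      (((n : ℚ) - 2 * (a : ℚ) + 1) • schurOfRows [n - a, a]) =
      ((n : ℚ) - 2 * (a : ℚ) + 1) * tableauCount f N (n - a) a 0 := by
    intro a ha
    rw [Finset.mem_Icc] at ha
    rw [schurOfRows_eq (sortedGE_two (by omega)), MvPowerSeries.coeff_smul,
      coeff_schur (mem_ofRowLens_two _) f hf]
  have h₃ : ∀ a ∈ Finset.Icc 1 ((n - 1) / 2), MvPowerSeries.coeff f
      (((n : ℚ) - 2 * (a : ℚ)) • schurOfRows [n - a - 1, a, 1]) =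
      ((n : ℚ) - 2 * (a : ℚ)) * tableauCount f N (n - a - 1) a 1 := by
    intro a ha
    rw [Finset.mem_Icc] at ha
    rw [schurOfRows_eq (sortedGE_three (by omega) (by omega)), MvPowerSeries.coeff_smul,
      coeff_schur (mem_ofRowLens_three _) f hf]
  rw [schurSide, map_add, map_add, map_sum, map_sum, h₁, Finset.sum_congr rfl h₂,
    Finset.sum_congr rfl h₃]
  split_ifs with h
  · rw [← one_add_sum_coeff f N n h.symm]
    push_cast
    congr 1
    congr 1
    · have := tableauCount_two_rows f N n 0 (Nat.zero_le _) h.symm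
      rw [Nat.cast_zero, coeffHH_zero, coeffHH_of_neg _ _ _ (by omega)] at this
      rw [sub_zero] at this
      exact_mod_cast this
    · refine Finset.sum_congr rfl fun a ha => ?_
      rw [Finset.mem_Icc] at ha
      rw [← Int.cast_natCast (tableauCount _ _ _ _ _),
        tableauCount_two_rows f N (n - a) a (by omega) (by omega)]
      push_cast
      rfl
    · refine Finset.sum_congr rfl fun a ha => ?_
      rw [Finset.mem_Icc] at ha
      rw [← Int.cast_natCast (tableauCount _ _ _ _ _),
        tableauCount_three_rows f N (n - a - 1) a (by omega) (by omega) (by omega)]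
      push_cast
      rfl
  · rw [tableauCount_eq_zero (by omega), Finset.sum_eq_zero, Finset.sum_eq_zero]
    · simp
    · intro a ha
      rw [Finset.mem_Icc] at ha
      rw [tableauCount_eq_zero (by omega)]
      simp
    · intro a ha
      rw [Finset.mem_Icc] at ha
      rw [tableauCount_eq_zero (by omega)]
      simp

theorem isSchurPositive_schur {μ : YoungDiagram} {n : ℕ} (hμ : μ.card = n) :
    IsSchurPositive n (schur μ) := by
  classical
  refine ⟨Finsupp.single μ 1, ?_, ?_, ?_⟩
  · intro ν hν
    rw [Finset.mem_singleton.1 (Finsupp.support_single_subset hν), hμ]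
  · intro ν
    rw [Finsupp.single_apply]
    split_ifs <;> norm_num
  · rw [Finsupp.sum_single_index (by simp), one_smul]

theorem IsSchurPositive.add {n : ℕ} {f g : MvPowerSeries ℕ ℚ} (hf : IsSchurPositive n f)
    (hg : IsSchurPositive n g) : IsSchurPositive n (f + g) := by
  classical
  obtain ⟨c, hc, hc', rfl⟩ := hf
  obtain ⟨d, hd, hd', rfl⟩ := hg
  refine ⟨c + d, ?_, fun μ => add_nonneg (hc' μ) (hd' μ), ?_⟩
  · intro μ hμ
    rcases Finset.mem_union.1 (Finsupp.support_add hμ) with h | h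
    · exact hc μ h
    · exact hd μ h
  · rw [Finsupp.sum_add_index' (by simp) (by simp [add_smul])]

theorem IsSchurPositive.smul {n : ℕ} {f : MvPowerSeries ℕ ℚ} (hf : IsSchurPositive n f)
    {a : ℚ} (ha : 0 ≤ a) : IsSchurPositive n (a • f) := by
  obtain ⟨c, hc, hc', rfl⟩ := hf
  refine ⟨a • c, fun μ hμ => hc μ (Finsupp.support_smul hμ),
    fun μ => mul_nonneg ha (hc' μ), ?_⟩
  rw [Finsupp.sum_smul_index' (by simp), Finsupp.smul_sum]
  simp [smul_smul]

theorem isSchurPositive_zero (n : ℕ) : IsSchurPositive n 0 :=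
  ⟨0, by simp, by simp, by simp⟩

theorem IsSchurPositive.sum {n : ℕ} {ι : Type*} {s : Finset ι} {f : ι → MvPowerSeries ℕ ℚ}
    (h : ∀ i ∈ s, IsSchurPositive n (f i)) : IsSchurPositive n (∑ i ∈ s, f i) :=
  Finset.sum_induction f _ (fun _ _ => IsSchurPositive.add) (isSchurPositive_zero n) h

theorem isSchurPositive_schurSide (n : ℕ) : IsSchurPositive n (schurSide n) := by
  refine (IsSchurPositive.add ?_ (IsSchurPositive.sum fun a ha => ?_)).add
    (IsSchurPositive.sum fun a ha => ?_)
  · rw [schurOfRows_eq (sortedGE_one n)]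
    exact isSchurPositive_schur (card_of_mem_iff (mem_ofRowLens_one _))
  · rw [Finset.mem_Icc] at ha
    have h : (2 * a : ℚ) ≤ n := by exact_mod_cast (by omega : 2 * a ≤ n)
    rw [schurOfRows_eq (sortedGE_two (by omega))]
    refine (isSchurPositive_schur ?_).smul (by linarith)
    rw [card_of_mem_iff (mem_ofRowLens_two _)]
    omega
  · rw [Finset.mem_Icc] at ha
    have h : (2 * a : ℚ) ≤ n := by exact_mod_cast (by omega : 2 * a ≤ n)
    rw [schurOfRows_eq (sortedGE_three (by omega) (by omega))]
    refine (isSchurPositive_schur ?_).smul (by linarith)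
    rw [card_of_mem_iff (mem_ofRowLens_three _)]
    omega

end StackedGrid

/-! ### Standardization and canonical words. -/

namespace StackedGrid

variable {n : ℕ}

/-- `π` is the standardization of the word `c`: the letters are ordered by size, equal letters from
left to right. -/
def IsStandardization (c : Fin n → Fin 3) (π : Equiv.Perm (Fin n)) : Prop :=
  ∀ p q, π p < π q ↔ c p < c q ∨ c p = c q ∧ p < q

theorem exists_isStandardization (c : Fin n → Fin 3) : ∃ π, IsStandardization c π := by
  obtain ⟨h₁, h₂⟩ := Tuple.eq_sort_iff.1 (rfl : Tuple.sort c = Tuple.sort c)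
  have key : ∀ i j, i < j → c (Tuple.sort c i) < c (Tuple.sort c j) ∨
      c (Tuple.sort c i) = c (Tuple.sort c j) ∧ Tuple.sort c i < Tuple.sort c j := by
    intro i j hij
    rcases (h₁ hij.le).lt_or_eq with h | h
    · exact Or.inl h
    · exact Or.inr ⟨h, h₂ i j hij h⟩
  refine ⟨(Tuple.sort c).symm, fun p q => ⟨fun h => ?_, fun h => ?_⟩⟩
  · simpa using key _ _ h
  · by_contra! h'
    rcases h'.lt_or_eq with h' | h'
    · have := key _ _ h'
      simp only [Equiv.apply_symm_apply] at this
      omega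
    · rw [(Tuple.sort c).symm.injective h'] at h
      omega

theorem IsStandardization.unique {c : Fin n → Fin 3} {π ρ : Equiv.Perm (Fin n)}
    (hπ : IsStandardization c π) (hρ : IsStandardization c ρ) : π = ρ := by
  have hmono : StrictMono fun i => ρ (π.symm i) := by
    intro i j hij
    rw [hρ, ← hπ]
    simpa using hij
  have := hmono.range_inj (strictMono_id) |>.1 (by
    rw [Set.range_id, Function.Surjective.range_eq]
    exact ρ.surjective.comp π.symm.surjective)
  ext p
  have h := congrFun this (π p)
  simp only [Equiv.symm_apply_apply, id] at h
  rw [h]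

/-- Every letter `a` that is used, except `0`, has an occurrence before some letter `a - 1`. -/
def IsTight (c : Fin n → Fin 3) : Prop :=
  ∀ p, c p ≠ 0 → ∃ q q', q < q' ∧ c q = c p ∧ (c q' : ℕ) + 1 = c p

/-- Going from a value to the next, the letter rises exactly when the position moves left. Tightness
excludes skipped letters, and also a rise while moving right: `u` would be the last occurrence of
its letter and `v` the first of the next one, leaving no inversion between the two letters. -/
theorem IsTight.eq_add {c : Fin n → Fin 3} (hc : IsTight c) {π : Equiv.Perm (Fin n)}
    (hπ : IsStandardization c π) {u v : Fin n} (huv : (π v : ℕ) = π u + 1) :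
    (c v : ℕ) = c u + if v < u then 1 else 0 := by
  have hlt := (hπ u v).1 (by omega)
  have hne : u ≠ v := by
    rintro rfl
    omega
  split_ifs with h
  · have hc0 : c v ≠ 0 := by omega
    obtain ⟨q, q', hq, h₁, h₂⟩ := hc v hc0
    have h₃ : π q' < π v := (hπ q' v).2 (Or.inl (by omega))
    have h₄ := (hπ u q').not.1 (by omega)
    omega
  · by_contra hcv
    have hc0 : c v ≠ 0 := by omega
    obtain ⟨q, q', hq, h₁, h₂⟩ := hc v hc0
    have h₃ : π q' < π v := (hπ q' v).2 (Or.inl (by omega))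
    have h₄ := (hπ u q').not.1 (by omega)
    have h₅ : π u < π q := (hπ u q).2 (Or.inl (by omega))
    have h₆ := (hπ q v).not.1 (by omega)
    omega

theorem IsTight.eq_zero {c : Fin n → Fin 3} (hc : IsTight c) {π : Equiv.Perm (Fin n)}
    (hπ : IsStandardization c π) {u : Fin n} (hu : (π u : ℕ) = 0) : c u = 0 := by
  by_contra h
  obtain ⟨q, q', -, h₁, h₂⟩ := hc u h
  have := (hπ q' u).2 (Or.inl (by omega))
  omega

/-- The letters are read back from `π` in the order of its values, starting from letter 0 at value
0. -/
theorem IsTight.injective {c d : Fin n → Fin 3} (hc : IsTight c) (hd : IsTight d)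
    {π : Equiv.Perm (Fin n)} (hcπ : IsStandardization c π) (hdπ : IsStandardization d π) :
    c = d := by
  have : ∀ k : ℕ, ∀ p, (π p : ℕ) = k → c p = d p := by
    intro k
    induction k with
    | zero =>
      intro p hp
      rw [hc.eq_zero hcπ hp, hd.eq_zero hdπ hp]
    | succ k ih =>
      intro p hp
      have hu : (π (π.symm ⟨k, by omega⟩) : ℕ) = k := by simp
      have h₁ := hc.eq_add hcπ (hp.trans (congrArg (· + 1) hu.symm))
      have h₂ := hd.eq_add hdπ (hp.trans (congrArg (· + 1) hu.symm))
      rw [ih _ hu] at h₁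
      omega
  exact funext fun p => this _ p rfl

/-- Some letter `b` occurs before some letter `a`. -/
def HasPair (b a : Fin 3) (c : Fin n → Fin 3) : Prop :=
  ∃ p q, p < q ∧ c p = b ∧ c q = a

/-- The words whose standardizations are the permutations of the stacked grid class with exactly one
descent of the inverse. -/
def IsTwoLetterWord (a b : Fin 3) (c : Fin n → Fin 3) : Prop :=
  (∀ p, c p = a ∨ c p = b) ∧ HasPair b a c

/-- The words whose standardizations are the permutations of the stacked grid class with exactly two
descents of the inverse. -/
def IsThreeLetterWord (c : Fin n → Fin 3) : Prop :=
  (∃ p, c p = 0) ∧ HasPair 2 1 c ∧ ¬ HasPair 0 1 c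

/-- The canonical words of the permutations of the stacked grid class. -/
def IsCanonical (c : Fin n → Fin 3) : Prop :=
  c = (fun _ => 0) ∨ IsTwoLetterWord 0 1 c ∨ IsThreeLetterWord c

theorem IsCanonical.isTight {c : Fin n → Fin 3} (hc : IsCanonical c) : IsTight c := by
  rcases hc with rfl | ⟨h, p, q, hpq, hp, hq⟩ | ⟨⟨z, hz⟩, ⟨p, q, hpq, hp, hq⟩, h⟩
  · intro p hp
    exact absurd rfl hp
  · intro r hr
    have := (h r).resolve_left hr
    exact ⟨p, q, hpq, by rw [hp, this], by rw [hq, this]; rfl⟩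
  · intro r hr
    obtain hr | hr : c r = 1 ∨ c r = 2 := by omega
    · refine ⟨r, z, ?_, rfl, by rw [hz, hr]; rfl⟩
      by_contra h'
      refine h ⟨z, r, lt_of_le_of_ne (not_lt.1 h') ?_, hz, hr⟩
      rintro rfl
      omega
    · exact ⟨p, q, hpq, by rw [hp, hr], by rw [hq, hr]; rfl⟩

theorem exists_canonical_of_two_letters {c : Fin n → Fin 3} (hc : ∀ p, c p = 0 ∨ c p = 1)
    {π : Equiv.Perm (Fin n)} (hπ : IsStandardization c π) :
    ∃ d, IsCanonical d ∧ IsStandardization d π := by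
  by_cases h : HasPair 1 0 c
  · exact ⟨c, Or.inr (Or.inl ⟨hc, h⟩), hπ⟩
  · refine ⟨fun _ => 0, Or.inl rfl, fun p q => (hπ p q).trans ?_⟩
    have h₁ := hc p
    have h₂ := hc q
    constructor
    · rintro (h' | ⟨-, h'⟩)
      · refine Or.inr ⟨rfl, ?_⟩
        by_contra h''
        refine h ⟨q, p, lt_of_le_of_ne (not_lt.1 h'') ?_, by omega, by omega⟩
        rintro rfl
        omega
      · exact Or.inr ⟨rfl, h'⟩
    · rintro (h' | ⟨-, h'⟩)
      · exact absurd h' (lt_irrefl _)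
      · by_contra h''
        exact h ⟨p, q, h', by omega, by omega⟩

/-- If no `2` precedes a `1`, these two letters can be merged without changing the standardization;
if `0` is absent, the other two letters can be lowered by one. Otherwise the word is already
canonical. -/
theorem exists_canonical {c : Fin n → Fin 3} (hc : ¬ HasPair 0 1 c) {π : Equiv.Perm (Fin n)}
    (hπ : IsStandardization c π) : ∃ d, IsCanonical d ∧ IsStandardization d π := by
  by_cases h : HasPair 2 1 c
  · by_cases h0 : ∃ p, c p = 0
    · exact ⟨c, Or.inr (Or.inr ⟨h0, h, hc⟩), hπ⟩
    · push Not at h0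
      refine exists_canonical_of_two_letters (c := fun p => if c p = 2 then 1 else 0) ?_ ?_
      · intro p
        split_ifs <;> simp
      · intro p q
        rw [hπ p q]
        have h₁ := h0 p
        have h₂ := h0 q
        dsimp only
        split_ifs <;> omega
  · refine exists_canonical_of_two_letters (c := fun p => if c p = 0 then 0 else 1) ?_ ?_
    · intro p
      split_ifs <;> simp
    · intro p q
      rw [hπ p q]
      have h₁ : ¬ (p < q ∧ c p = 2 ∧ c q = 1) := fun h' => h ⟨p, q, h'⟩
      have h₂ : ¬ (q < p ∧ c q = 2 ∧ c p = 1) := fun h' => h ⟨q, p, h'⟩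
      have h₃ : p = q → c p = c q := congrArg c
      dsimp only
      split_ifs <;> omega

/-! ### The grid class as a set of standardizations. -/

theorem mem_gridFigure_matrixJ (x : ℝ × ℝ) : x ∈ gridFigure matrixJ ↔
    (0 ≤ x.1 ∧ x.1 ≤ 2 ∧ x.2 = x.1 + 2) ∨ (0 ≤ x.1 ∧ x.1 ≤ 1 ∧ x.2 = x.1 + 1) ∨
      (1 ≤ x.1 ∧ x.1 ≤ 2 ∧ x.2 = x.1 - 1) := by
  constructor
  · rintro ⟨i, j, t, h0, h1, hx, h⟩
    fin_cases i <;> fin_cases j <;> simp [matrixJ] at hx h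
    · exact Or.inl ⟨by linarith, by linarith, by linarith⟩
    · exact Or.inl ⟨by linarith, by linarith, by linarith⟩
    · exact Or.inr (Or.inl ⟨by linarith, by linarith, by linarith⟩)
    · exact Or.inr (Or.inr ⟨by linarith, by linarith, by linarith⟩)
  · rintro (⟨h0, h1, h⟩ | ⟨h0, h1, h⟩ | ⟨h0, h1, h⟩)
    · rcases le_total x.1 1 with h2 | h2
      · refine ⟨1, 0, x.1, h0, h2, by simp, Or.inl ⟨by simp [matrixJ], ?_⟩⟩
        norm_num
        linarith
      · refine ⟨0, 1, x.1 - 1, by linarith, by linarith, by simp, Or.inl ⟨by simp [matrixJ], ?_⟩⟩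
        norm_num
        linarith
    · refine ⟨2, 0, x.1, h0, h1, by simp, Or.inl ⟨by simp [matrixJ], ?_⟩⟩
      norm_num
      linarith
    · refine ⟨3, 1, x.1 - 1, by linarith, by linarith, by simp, Or.inl ⟨by simp [matrixJ], ?_⟩⟩
      norm_num
      linarith

theorem exists_word_of_mem_classJ {π : Equiv.Perm (Fin n)} (hπ : π ∈ classJ n) :
    ∃ c, ¬ HasPair 0 1 c ∧ IsStandardization c π := by
  classical
  obtain ⟨d, hd, hx, hy⟩ := hπ
  simp only [mem_gridFigure_matrixJ] at hd
  let c : Fin n → Fin 3 := fun k =>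
    -- The letters number the three segments from bottom to top; the segments lie on distinct
    -- parallel lines.
    if (d k).2 = (d k).1 + 2 then 2 else if (d k).2 = (d k).1 + 1 then 1 else 0
  have hc : ∀ k, (c k = 2 ∧ 0 ≤ (d k).1 ∧ (d k).2 = (d k).1 + 2) ∨
      (c k = 1 ∧ (d k).1 ≤ 1 ∧ 0 ≤ (d k).1 ∧ (d k).2 = (d k).1 + 1) ∨
      (c k = 0 ∧ 1 ≤ (d k).1 ∧ (d k).1 ≤ 2 ∧ (d k).2 = (d k).1 - 1) := by
    intro k
    rcases hd k with ⟨h0, h1, h⟩ | ⟨h0, h1, h⟩ | ⟨h0, h1, h⟩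
    · exact Or.inl ⟨if_pos h, h0, h⟩
    · refine Or.inr (Or.inl ⟨?_, h1, h0, h⟩)
      simp only [c]
      rw [if_neg (by linarith), if_pos h]
    · refine Or.inr (Or.inr ⟨?_, h0, h1, h⟩)
      simp only [c]
      rw [if_neg (by linarith), if_neg (by linarith)]
  have hinj : ∀ p q, (d p).2 = (d q).2 → p = q := by
    intro p q h
    refine π.injective (le_antisymm (not_lt.1 ?_) (not_lt.1 ?_)) <;> rw [hy, h] <;>
      exact lt_irrefl _
  have key : ∀ p q, c p < c q ∨ c p = c q ∧ p < q → (d p).2 < (d q).2 := by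
    intro p q h
    -- Geometry gives only a weak inequality, since consecutive segments share a boundary height;
    -- strictness comes from the distinct `y`-coordinates.
    have hle : (d p).2 ≤ (d q).2 := by
      have hx' : p < q → (d p).1 < (d q).1 := hx p q
      rcases hc p with ⟨h₁, h₂⟩ | ⟨h₁, h₂⟩ | ⟨h₁, h₂⟩ <;>
      rcases hc q with ⟨h₃, h₄⟩ | ⟨h₃, h₄⟩ | ⟨h₃, h₄⟩ <;>
      simp [h₁, h₃] at h <;> (try have := hx' h) <;> linarith
    refine hle.lt_of_ne fun h' => ?_
    obtain rfl := hinj p q h'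
    omega
  refine ⟨c, ?_, fun p q => (hy p q).trans ⟨fun h => ?_, key p q⟩⟩
  · rintro ⟨p, q, hpq, hp, hq⟩
    have := hx p q hpq
    rcases hc p with ⟨h₁, h₂⟩ | ⟨h₁, h₂⟩ | ⟨h₁, h₂⟩ <;>
      rcases hc q with ⟨h₃, h₄⟩ | ⟨h₃, h₄⟩ | ⟨h₃, h₄⟩ <;> first | omega | linarith
  · by_contra h'
    obtain rfl | hpq := eq_or_ne p q
    · exact lt_irrefl _ h
    · exact h.not_gt (key q p (by omega))

theorem mem_classJ_of_word {π : Equiv.Perm (Fin n)} {c : Fin n → Fin 3} (hc : ¬ HasPair 0 1 c)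
    (hπ : IsStandardization c π) : π ∈ classJ n := by
  classical
  -- The dots move to the right column from the first `0` on. Every `1` lies before that, hence
  -- stays left, and the letter `2` is allowed in both columns.
  let s : Fin n → ℝ := fun p => if ∃ q ≤ p, c q = 0 then 1 else 0
  let x : Fin n → ℝ := fun p => ((p : ℕ) + 1 : ℝ) / (n + 1) + s p
  have hpos : (0 : ℝ) < n + 1 := by positivity
  have hfrac : ∀ p : Fin n, 0 < ((p : ℕ) + 1 : ℝ) / (n + 1) ∧
      ((p : ℕ) + 1 : ℝ) / (n + 1) < 1 := by
    intro p
    refine ⟨by positivity, (div_lt_one hpos).2 ?_⟩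
    have : (p : ℕ) < n := p.2
    have : ((p : ℕ) : ℝ) < n := by exact_mod_cast this
    linarith
  have hs0 : ∀ p, c p = 0 → s p = 1 := fun p hp => if_pos ⟨p, le_rfl, hp⟩
  have hs1 : ∀ p, c p = 1 → s p = 0 := by
    intro p hp
    refine if_neg ?_
    rintro ⟨q, hq, hq0⟩
    refine hc ⟨q, p, lt_of_le_of_ne hq ?_, hq0, hp⟩
    rintro rfl
    omega
  have hs : ∀ p, s p = 0 ∨ s p = 1 := by
    intro p
    simp only [s]
    split_ifs <;> simp
  have hsm : ∀ p q, p ≤ q → s p ≤ s q := by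
    intro p q hpq
    simp only [s]
    split_ifs with h₁ h₂
    · exact le_rfl
    · obtain ⟨r, hr, hr'⟩ := h₁
      exact absurd ⟨r, hr.trans hpq, hr'⟩ h₂
    · exact zero_le_one
    · exact le_rfl
  have hx : ∀ p q, p < q → x p < x q := by
    intro p q hpq
    have h₁ := hsm p q hpq.le
    have h₂ : ((p : ℕ) + 1 : ℝ) / (n + 1) < ((q : ℕ) + 1 : ℝ) / (n + 1) := by
      refine div_lt_div_of_pos_right ?_ hpos
      have : ((p : ℕ) : ℝ) < (q : ℕ) := by exact_mod_cast hpq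
      linarith
    simp only [x]
    linarith
  let y : Fin n → ℝ := fun p => if c p = 2 then x p + 2 else if c p = 1 then x p + 1 else x p - 1
  have hxy : ∀ p, (c p = 2 ∧ y p = x p + 2 ∧ 0 < x p ∧ x p < 2) ∨
      (c p = 1 ∧ y p = x p + 1 ∧ 0 < x p ∧ x p < 1) ∨
      (c p = 0 ∧ y p = x p - 1 ∧ 1 < x p ∧ x p < 2) := by
    intro p
    have h₁ := hfrac p
    obtain h | h | h : c p = 2 ∨ c p = 1 ∨ c p = 0 := by omega
    · refine Or.inl ⟨h, if_pos h, ?_⟩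
      rcases hs p with h' | h' <;> simp only [x, h'] <;> constructor <;> linarith
    · refine Or.inr (Or.inl ⟨h, by simp [y, h], ?_⟩)
      simp only [x, hs1 p h]
      constructor <;> linarith
    · refine Or.inr (Or.inr ⟨h, by simp [y, h], ?_⟩)
      simp only [x, hs0 p h]
      constructor <;> linarith
  have key : ∀ p q, c p < c q ∨ c p = c q ∧ p < q → y p < y q := by
    intro p q h
    have hx' : p < q → x p < x q := hx p q
    rcases hxy p with ⟨h₁, h₂⟩ | ⟨h₁, h₂⟩ | ⟨h₁, h₂⟩ <;>
      rcases hxy q with ⟨h₃, h₄⟩ | ⟨h₃, h₄⟩ | ⟨h₃, h₄⟩ <;>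
      simp [h₁, h₃] at h <;> (try have := hx' h) <;> linarith
  refine ⟨fun p => (x p, y p), fun p => (mem_gridFigure_matrixJ _).2 ?_, hx, fun p q => ?_⟩
  · dsimp only
    rcases hxy p with ⟨h₁, h₂, h₃, h₄⟩ | ⟨h₁, h₂, h₃, h₄⟩ | ⟨h₁, h₂, h₃, h₄⟩
    · exact Or.inl ⟨h₃.le, h₄.le, h₂⟩
    · exact Or.inr (Or.inl ⟨h₃.le, h₄.le, h₂⟩)
    · exact Or.inr (Or.inr ⟨h₃.le, h₄.le, h₂⟩)
  · refine (hπ p q).trans ⟨key p q, fun h => ?_⟩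
    by_contra h'
    obtain rfl | hpq := eq_or_ne p q
    · exact lt_irrefl _ h
    · exact lt_asymm h (key q p (by omega))

theorem mem_classJ_iff {π : Equiv.Perm (Fin n)} :
    π ∈ classJ n ↔ ∃ c, IsCanonical c ∧ IsStandardization c π := by
  constructor
  · intro h
    obtain ⟨c, hc, hπ⟩ := exists_word_of_mem_classJ h
    exact exists_canonical hc hπ
  · rintro ⟨c, hc, hπ⟩
    by_cases h : HasPair 0 1 c
    · have hc' : ∀ p, c p = 0 ∨ c p = 1 := by
        rcases hc with rfl | hc | hc
        · exact fun _ => Or.inl rfl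
        · exact hc.1
        · exact absurd h hc.2.2
      -- A two-letter word may have a `0` before a `1`; it is then realized on the two segments `1`
      -- and `2`, whose letters are unconstrained relative to each other.
      refine mem_classJ_of_word (c := fun p => if c p = 0 then 1 else 2) ?_ fun p q => ?_
      · rintro ⟨p, q, -, hp, -⟩
        dsimp only at hp
        split_ifs at hp <;> omega
      · rw [hπ p q]
        have h₁ := hc' p
        have h₂ := hc' q
        dsimp only
        split_ifs <;> omega
    · exact mem_classJ_of_word h hπ

/-- A word is weakly increasing on the blocks, that is, on the fibres of `i`. -/
def IsBlockMonotone (i : Fin n → ℕ) (c : Fin n → Fin 3) : Prop :=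
  ∀ p q, p < q → i p = i q → c p ≤ c q

theorem IsStandardization.isBlockMonotone_iff {c : Fin n → Fin 3} {π : Equiv.Perm (Fin n)}
    (hπ : IsStandardization c π) (i : Fin n → ℕ) :
    IsBlockMonotone i c ↔ ∀ p q, p < q → i p = i q → π p < π q := by
  refine forall₄_congr fun p q h _ => ?_
  rw [hπ p q]
  omega

/-- Standardization is a bijection from canonical words to the class, and it preserves being
increasing on blocks because equal letters are ordered from left to right. -/
theorem ncard_classJ (i : Fin n → ℕ) :
    {π | π ∈ classJ n ∧ ∀ p q, p < q → i p = i q → π p < π q}.ncard =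
      {c : Fin n → Fin 3 | IsBlockMonotone i c ∧ IsCanonical c}.ncard := by
  choose std hstd using fun c : Fin n → Fin 3 => exists_isStandardization c
  rw [← Set.InjOn.ncard_image (f := std)]
  · congr 1
    ext π
    constructor
    · rintro ⟨h₁, h₂⟩
      obtain ⟨c, hc, hπ⟩ := mem_classJ_iff.1 h₁
      exact ⟨c, ⟨(hπ.isBlockMonotone_iff i).2 h₂, hc⟩, (hstd c).unique hπ⟩
    · rintro ⟨c, ⟨h₁, h₂⟩, rfl⟩
      exact ⟨mem_classJ_iff.2 ⟨c, h₂, hstd c⟩, ((hstd c).isBlockMonotone_iff i).1 h₁⟩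
  · intro c hc d hd h
    exact hc.2.isTight.injective hd.2.isTight (hstd c) (h ▸ hstd d)

end StackedGrid

/-! ### Counting block-monotone canonical words, one block at a time. -/

namespace StackedGrid

/-- The block that contains a position, when the blocks have the sizes `m 0, m 1, …`. -/
def blockIndex (m : ℕ → ℕ) : (N : ℕ) → Fin (psum m N) → ℕ
  | 0 => fun _ => 0
  | N + 1 => Fin.append (blockIndex m N) (fun _ : Fin (m N) => N)

theorem blockIndex_lt (m : ℕ → ℕ) (N : ℕ) (p : Fin (psum m N)) : blockIndex m N p < N := by
  induction N with
  | zero => exact absurd p.2 (Nat.not_lt_zero _)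
  | succ N ih =>
    refine Fin.addCases (m := psum m N) (n := m N) (fun q => ?_) (fun q => ?_) p
    · rw [blockIndex, Fin.append_left]
      exact (ih q).trans (Nat.lt_succ_self N)
    · rw [blockIndex, Fin.append_right]
      exact Nat.lt_succ_self N

section Append

variable {n e : ℕ} {w : Fin n → Fin 3} {s : Fin e → Fin 3}

theorem forall_append {P : Fin 3 → Prop} :
    (∀ p, P (Fin.append w s p)) ↔ (∀ p, P (w p)) ∧ ∀ p, P (s p) := by
  constructor
  · exact fun h => ⟨fun p => by simpa using h (Fin.castAdd e p),
      fun p => by simpa using h (Fin.natAdd n p)⟩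
  · rintro ⟨h₁, h₂⟩ p
    refine Fin.addCases (fun q => ?_) (fun q => ?_) p
    · simpa using h₁ q
    · simpa using h₂ q

theorem exists_append {P : Fin 3 → Prop} :
    (∃ p, P (Fin.append w s p)) ↔ (∃ p, P (w p)) ∨ ∃ p, P (s p) := by
  have := forall_append (w := w) (s := s) (P := fun x => ¬ P x)
  grind

theorem hasPair_append {a b : Fin 3} : HasPair b a (Fin.append w s) ↔
    HasPair b a w ∨ HasPair b a s ∨ (∃ p, w p = b) ∧ ∃ q, s q = a := by
  constructor
  · rintro ⟨p, q, hpq, hp, hq⟩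
    induction p using Fin.addCases with
    | left p =>
      rw [Fin.append_left] at hp
      induction q using Fin.addCases with
      | left q =>
        rw [Fin.append_left] at hq
        exact Or.inl ⟨p, q, hpq, hp, hq⟩
      | right q =>
        rw [Fin.append_right] at hq
        exact Or.inr (Or.inr ⟨⟨p, hp⟩, q, hq⟩)
    | right p =>
      rw [Fin.append_right] at hp
      induction q using Fin.addCases with
      | left q =>
        have : n + (p : ℕ) < q := hpq
        omega
      | right q =>
        rw [Fin.append_right] at hq
        exact Or.inr (Or.inl ⟨p, q, by simpa using hpq, hp, hq⟩)
  · rintro (⟨p, q, hpq, hp, hq⟩ | ⟨p, q, hpq, hp, hq⟩ | ⟨⟨p, hp⟩, q, hq⟩)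
    · exact ⟨Fin.castAdd e p, Fin.castAdd e q, hpq, by simpa, by simpa⟩
    · exact ⟨Fin.natAdd n p, Fin.natAdd n q, by simpa using hpq, by simpa, by simpa⟩
    · refine ⟨Fin.castAdd e p, Fin.natAdd n q, ?_, by simpa, by simpa⟩
      have : (p : ℕ) < n + q := by omega
      exact this

theorem ncard_append {P : (Fin (n + e) → Fin 3) → Prop} {A : (Fin n → Fin 3) → Prop}
    {B : (Fin e → Fin 3) → Prop} (h : ∀ w s, P (Fin.append w s) ↔ A w ∧ B s) :
    {c | P c}.ncard = {w | A w}.ncard * {s | B s}.ncard := by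
  rw [← Set.ncard_prod, ← Set.ncard_image_of_injective _ (Fin.appendEquiv n e).injective]
  congr 1
  ext c
  obtain ⟨⟨w, s⟩, rfl⟩ := (Fin.appendEquiv n e).surjective c
  rw [Set.mem_image_equiv, Equiv.symm_apply_apply]
  exact h w s

theorem ncard_append_or {P : (Fin (n + e) → Fin 3) → Prop} {A A' : (Fin n → Fin 3) → Prop}
    {B B' : (Fin e → Fin 3) → Prop}
    (h : ∀ w s, P (Fin.append w s) ↔ A w ∧ B s ∨ A' w ∧ B' s) (hA : ∀ w, A w → ¬ A' w) :
    {c | P c}.ncard = {w | A w}.ncard * {s | B s}.ncard +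
      {w | A' w}.ncard * {s | B' s}.ncard := by
  let f := (Fin.appendEquiv (α := Fin 3) n e).symm
  have h₁ : ∀ c, P c ↔ A (f c).1 ∧ B (f c).2 ∨ A' (f c).1 ∧ B' (f c).2 := by
    intro c
    obtain ⟨⟨w, s⟩, rfl⟩ := (Fin.appendEquiv n e).surjective c
    simp only [f, Equiv.symm_apply_apply]
    exact h w s
  rw [← ncard_append (P := fun c => A (f c).1 ∧ B (f c).2) (fun w s => by simp [f, Fin.appendEquiv]),
    ← ncard_append (P := fun c => A' (f c).1 ∧ B' (f c).2) (fun w s => by simp [f, Fin.appendEquiv]),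
    ← Set.ncard_union_eq]
  · congr 1
    ext c
    exact h₁ c
  · rw [Set.disjoint_left]
    exact fun c h₁ h₂ => hA _ h₁.1 h₂.1

end Append

theorem isBlockMonotone_append {m : ℕ → ℕ} {N : ℕ} {w : Fin (psum m N) → Fin 3}
    {s : Fin (m N) → Fin 3} :
    IsBlockMonotone (blockIndex m (N + 1)) (Fin.append w s) ↔
      IsBlockMonotone (blockIndex m N) w ∧ Monotone s := by
  have hl : ∀ p, blockIndex m (N + 1) (Fin.castAdd (m N) p) = blockIndex m N p := by
    intro p
    rw [blockIndex, Fin.append_left]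
  have hr : ∀ p, blockIndex m (N + 1) (Fin.natAdd (psum m N) p) = N := by
    intro p
    rw [blockIndex, Fin.append_right]
  constructor
  · intro h
    refine ⟨fun p q hpq hi => ?_, fun p q hpq => ?_⟩
    · simpa using h (Fin.castAdd (m N) p) (Fin.castAdd (m N) q) hpq (by rw [hl, hl, hi])
    · rcases hpq.lt_or_eq with hpq | rfl
      · simpa using h (Fin.natAdd _ p) (Fin.natAdd _ q) (Nat.add_lt_add_left hpq _)
          (by rw [hr, hr])
      · exact le_rfl
  · rintro ⟨h₁, h₂⟩ (p : Fin (psum m N + m N)) (q : Fin (psum m N + m N)) hpq hi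
    induction p using Fin.addCases with
    | left p =>
      have hp := blockIndex_lt m N p
      induction q using Fin.addCases with
      | left q =>
        rw [hl, hl] at hi
        simpa using h₁ p q hpq hi
      | right q =>
        rw [hl, hr] at hi
        omega
    | right p =>
      induction q using Fin.addCases with
      | left q =>
        have : psum m N + (p : ℕ) < q := hpq
        omega
      | right q =>
        have : p < q := Nat.lt_of_add_lt_add_left hpq
        simpa using h₂ this.le

/-- The weakly increasing words in the letters `a < b` are determined by the number of `a`s. -/
theorem ncard_monotone_words {a b : Fin 3} (hab : a < b) (e : ℕ) :
    {s : Fin e → Fin 3 | Monotone s ∧ ∀ p, s p = a ∨ s p = b}.ncard = e + 1 := by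
  classical
  let f : ℕ → Fin e → Fin 3 := fun j p => if (p : ℕ) < j then a else b
  have hf : ∀ j p, f j p = a ↔ (p : ℕ) < j := by
    intro j p
    simp only [f]
    split_ifs with h
    · simpa using h
    · simpa [h] using hab.ne'
  have : {s : Fin e → Fin 3 | Monotone s ∧ ∀ p, s p = a ∨ s p = b} =
      f '' (Finset.range (e + 1) : Finset ℕ) := by
    ext s
    constructor
    · rintro ⟨h₁, h₂⟩
      let P : ℕ → Prop := fun j => ∃ h : j < e, s ⟨j, h⟩ = a
      refine ⟨((Finset.range e).filter P).card, ?_, ?_⟩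
      · have := Finset.card_filter_le (Finset.range e) P
        rw [Finset.card_range] at this
        simpa using Nat.lt_succ_of_le this
      · funext p
        have hP : P p ↔ s p = a := ⟨fun ⟨_, h⟩ => h, fun h => ⟨p.2, h⟩⟩
        have key := mem_iff_lt_card_filter e P (by
          rintro j₁ j₂ hj hlt ⟨h, hs⟩
          refine ⟨hj.trans_lt hlt, ?_⟩
          have hle : s ⟨j₁, hj.trans_lt hlt⟩ ≤ s ⟨j₂, h⟩ := h₁ hj
          have := h₂ ⟨j₁, hj.trans_lt hlt⟩
          rw [hs] at hle
          omega) p p.2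
        have h₃ := hf ((Finset.range e).filter P).card p
        rw [← key, hP] at h₃
        have h₄ := h₂ p
        have h₅ : f ((Finset.range e).filter P).card p = a ∨
            f ((Finset.range e).filter P).card p = b := by
          simp only [f]
          split_ifs <;> simp
        grind
    · rintro ⟨j, -, rfl⟩
      refine ⟨fun p q hpq => ?_, fun p => ?_⟩
      · simp only [f]
        have : (p : ℕ) ≤ q := hpq
        split_ifs <;> omega
      · simp only [f]
        split_ifs <;> simp
  rw [this, Set.InjOn.ncard_image, Set.ncard_coe_finset, Finset.card_range]
  intro j hj k hk h
  simp only [Finset.coe_range, Set.mem_Iio] at hj hk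
  by_contra hne
  rcases lt_or_gt_of_ne hne with hlt | hlt
  · have h₁ := hf j ⟨j, by omega⟩
    have h₂ := hf k ⟨j, by omega⟩
    rw [h] at h₁
    exact lt_irrefl j (h₁.1 (h₂.2 hlt))
  · have h₁ := hf j ⟨k, by omega⟩
    have h₂ := hf k ⟨k, by omega⟩
    rw [h] at h₁
    exact lt_irrefl k (h₂.1 (h₁.2 hlt))

theorem ncard_monotone_words_used {a b : Fin 3} (hab : a < b) (e : ℕ) :
    {s : Fin e → Fin 3 | (Monotone s ∧ ∀ p, s p = a ∨ s p = b) ∧ ∃ p, s p = a}.ncard = e := by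
  have h : {s : Fin e → Fin 3 | Monotone s ∧ ∀ p, s p = a ∨ s p = b} =
      insert (fun _ => b)
        {s : Fin e → Fin 3 | (Monotone s ∧ ∀ p, s p = a ∨ s p = b) ∧ ∃ p, s p = a} := by
    ext s
    simp only [Set.mem_ofPred_eq, Set.mem_insert_iff]
    constructor
    · intro h
      by_cases hs : ∃ p, s p = a
      · exact Or.inr ⟨h, hs⟩
      · push Not at hs
        exact Or.inl (funext fun p => (h.2 p).resolve_left (hs p))
    · rintro (rfl | h)
      · exact ⟨monotone_const, fun _ => Or.inr rfl⟩
      · exact h.1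
  have h' := ncard_monotone_words hab e
  rw [h, Set.ncard_insert_of_notMem] at h'
  · omega
  · rintro ⟨-, p, hp⟩
    exact hab.ne' hp

theorem not_hasPair_of_monotone {e : ℕ} {s : Fin e → Fin 3} (hs : Monotone s) {a b : Fin 3}
    (hab : a < b) : ¬ HasPair b a s := by
  rintro ⟨p, q, hpq, hp, hq⟩
  have := hs hpq.le
  omega

section Count

variable (m : ℕ → ℕ)

theorem ncard_blockMonotone {a b : Fin 3} (hab : a < b) (N : ℕ) :
    ({c | IsBlockMonotone (blockIndex m N) c ∧ ∀ p, c p = a ∨ c p = b}.ncard : ℤ) =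
      subCount m N := by
  induction N with
  | zero =>
    have : {c : Fin (psum m 0) → Fin 3 |
        IsBlockMonotone (blockIndex m 0) c ∧ ∀ p, c p = a ∨ c p = b} = {fun _ => a} := by
      ext c
      constructor
      · intro _
        exact funext fun p => absurd p.2 (Nat.not_lt_zero _)
      · intro _
        exact ⟨fun p => absurd p.2 (Nat.not_lt_zero _), fun p => absurd p.2 (Nat.not_lt_zero _)⟩
    rw [this, Set.ncard_singleton]
    rfl
  | succ N ih =>
    have := ncard_append (n := psum m N) (e := m N)
      (P := fun c => IsBlockMonotone (blockIndex m (N + 1)) c ∧ ∀ p, c p = a ∨ c p = b)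
      (A := fun w => IsBlockMonotone (blockIndex m N) w ∧ ∀ p, w p = a ∨ w p = b)
      (B := fun s => Monotone s ∧ ∀ p, s p = a ∨ s p = b) (by
        intro w s
        have h₁ := isBlockMonotone_append (w := w) (s := s)
        have h₂ := forall_append (w := w) (s := s) (P := fun x => x = a ∨ x = b)
        exact (and_congr h₁ h₂).trans and_and_and_comm)
    rw [ncard_monotone_words hab] at this
    rw [subCount, ← ih]
    exact_mod_cast this

/-- Of the `subCount` block-monotone words, exactly the `psum m N + 1` sorted ones have no `b`
before an `a`. -/
theorem ncard_twoLetterWord {a b : Fin 3} (hab : a < b) (N : ℕ) :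
    ({c | IsBlockMonotone (blockIndex m N) c ∧ IsTwoLetterWord a b c}.ncard : ℤ) =
      subCount m N - psum m N - 1 := by
  induction N with
  | zero =>
    have : {c : Fin (psum m 0) → Fin 3 |
        IsBlockMonotone (blockIndex m 0) c ∧ IsTwoLetterWord a b c} = ∅ := by
      ext c
      simp only [Set.mem_ofPred_eq, Set.mem_empty_iff_false, iff_false]
      rintro ⟨-, -, p, -⟩
      exact absurd p.2 (Nat.not_lt_zero _)
    rw [this, Set.ncard_empty]
    rfl
  | succ N ih =>
    -- Words in `a, b` either have an inversion, or are sorted and contain `b`, or are constantly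
    -- `a`. Only in the second case can a new block create the first inversion, by containing an
    -- `a`.
    have hrest : ({w | IsBlockMonotone (blockIndex m N) w ∧ ∀ p, w p = a ∨ w p = b}.ncard : ℤ) =
        {w | IsBlockMonotone (blockIndex m N) w ∧ IsTwoLetterWord a b w}.ncard +
        {w | IsBlockMonotone (blockIndex m N) w ∧ (∀ p, w p = a ∨ w p = b) ∧ ¬ HasPair b a w ∧
          ∃ p, w p = b}.ncard + 1 := by
      rw [show {w | IsBlockMonotone (blockIndex m N) w ∧ ∀ p, w p = a ∨ w p = b} =
        insert (fun _ => a) ({w | IsBlockMonotone (blockIndex m N) w ∧ IsTwoLetterWord a b w} ∪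
        {w | IsBlockMonotone (blockIndex m N) w ∧ (∀ p, w p = a ∨ w p = b) ∧ ¬ HasPair b a w ∧
          ∃ p, w p = b}) from ?_, Set.ncard_insert_of_notMem, Set.ncard_union_eq]
      · push_cast
        ring
      · rw [Set.disjoint_left]
        exact fun w h h' => h'.2.2.1 h.2.2
      · rintro (⟨-, -, p, q, -, hp, -⟩ | ⟨-, -, -, p, hp⟩)
        · exact hab.ne hp
        · exact hab.ne hp
      · ext w
        simp only [Set.mem_ofPred_eq, Set.mem_insert_iff, Set.mem_union, IsTwoLetterWord]
        constructor
        · rintro ⟨h₁, h₂⟩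
          by_cases h₃ : ∃ p, w p = b
          · right
            by_cases h₄ : HasPair b a w
            · exact Or.inl ⟨h₁, h₂, h₄⟩
            · exact Or.inr ⟨h₁, h₂, h₄, h₃⟩
          · push Not at h₃
            exact Or.inl (funext fun p => (h₂ p).resolve_right (h₃ p))
        · rintro (rfl | h | h)
          · exact ⟨fun _ _ _ _ => le_rfl, fun _ => Or.inl rfl⟩
          · exact ⟨h.1, h.2.1⟩
          · exact ⟨h.1, h.2.1⟩
    have := ncard_append_or (n := psum m N) (e := m N)
      (P := fun c => IsBlockMonotone (blockIndex m (N + 1)) c ∧ IsTwoLetterWord a b c)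
      (A := fun w => IsBlockMonotone (blockIndex m N) w ∧ IsTwoLetterWord a b w)
      (B := fun s => Monotone s ∧ ∀ p, s p = a ∨ s p = b)
      (A' := fun w => IsBlockMonotone (blockIndex m N) w ∧ (∀ p, w p = a ∨ w p = b) ∧
        ¬ HasPair b a w ∧ ∃ p, w p = b)
      (B' := fun s => (Monotone s ∧ ∀ p, s p = a ∨ s p = b) ∧ ∃ p, s p = a) (by
        intro w s
        have h₁ := isBlockMonotone_append (w := w) (s := s)
        have h₂ := forall_append (w := w) (s := s) (P := fun x => x = a ∨ x = b)
        have h₃ := hasPair_append (w := w) (s := s) (a := a) (b := b)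
        have h₄ := fun hs : Monotone s => not_hasPair_of_monotone hs hab
        have h₅ : HasPair b a w → ∃ p, w p = b := fun ⟨p, _, _, hp, _⟩ => ⟨p, hp⟩
        simp only [IsTwoLetterWord]
        refine (and_congr h₁ (and_congr h₂ h₃)).trans ?_
        tauto)
      (fun w h h' => h'.2.2.1 h.2.2)
    rw [ncard_monotone_words hab, ncard_monotone_words_used hab] at this
    rw [ncard_blockMonotone m hab] at hrest
    refine (congrArg Nat.cast this).trans ?_
    push_cast
    rw [subCount, psum]
    push_cast
    linear_combination (-(m N : ℤ)) * hrest + ih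

/-- The last block contains no `1`: some `0` would precede it. So either the earlier part is already
a three-letter word and the block is any sorted word in `0, 2`, or the earlier part has only the
letters `1, 2` with an inversion and the block supplies the first `0`. -/
theorem ncard_threeLetterWord (N : ℕ) :
    ({c | IsBlockMonotone (blockIndex m N) c ∧ IsThreeLetterWord c}.ncard : ℤ) =
      subCountErase m N - 2 * subCount m N + psum m N + 2 := by
  induction N with
  | zero =>
    have : {c : Fin (psum m 0) → Fin 3 |
        IsBlockMonotone (blockIndex m 0) c ∧ IsThreeLetterWord c} = ∅ := by
      ext c
      simp only [Set.mem_ofPred_eq, Set.mem_empty_iff_false, iff_false]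
      rintro ⟨-, ⟨p, -⟩, -⟩
      exact absurd p.2 (Nat.not_lt_zero _)
    rw [this, Set.ncard_empty]
    rfl
  | succ N ih =>
    have := ncard_append_or (n := psum m N) (e := m N)
      (P := fun c => IsBlockMonotone (blockIndex m (N + 1)) c ∧ IsThreeLetterWord c)
      (A := fun w => IsBlockMonotone (blockIndex m N) w ∧ IsThreeLetterWord w)
      (B := fun s => Monotone s ∧ ∀ p, s p = 0 ∨ s p = 2)
      (A' := fun w => IsBlockMonotone (blockIndex m N) w ∧ IsTwoLetterWord 1 2 w)
      (B' := fun s => (Monotone s ∧ ∀ p, s p = 0 ∨ s p = 2) ∧ ∃ p, s p = 0) (by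
        intro w s
        have h₁ := isBlockMonotone_append (w := w) (s := s)
        have h₂ := exists_append (w := w) (s := s) (P := fun x => x = 0)
        have h₃ := hasPair_append (w := w) (s := s) (a := 1) (b := 2)
        have h₄ := hasPair_append (w := w) (s := s) (a := 1) (b := 0)
        have h₅ := fun hs : Monotone s => not_hasPair_of_monotone hs (show (1 : Fin 3) < 2 by decide)
        have h₆ : HasPair 0 1 s → ∃ p, s p = 1 := fun ⟨_, p, _, _, hp⟩ => ⟨p, hp⟩
        have h₇ : HasPair 0 1 w → ∃ p, w p = 0 := fun ⟨p, _, _, hp, _⟩ => ⟨p, hp⟩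
        have h₈ : (∀ p, s p = 0 ∨ s p = 2) ↔ ¬ ∃ p, s p = 1 := by
          rw [not_exists]
          exact forall_congr' fun p => by omega
        have h₉ : (∀ p, w p = 1 ∨ w p = 2) ↔ ¬ ∃ p, w p = 0 := by
          rw [not_exists]
          exact forall_congr' fun p => by omega
        have h₁₀ : Monotone s → (∃ p, s p = 0) → (∃ p, s p = 1) → HasPair 0 1 s := by
          rintro hs ⟨p, hp⟩ ⟨q, hq⟩
          refine ⟨p, q, ?_, hp, hq⟩
          by_contra hpq
          have := hs (not_lt.1 hpq)
          omega
        simp only [IsTwoLetterWord, IsThreeLetterWord]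
        refine (and_congr h₁ (and_congr h₂ (and_congr h₃ (not_congr h₄)))).trans ?_
        rw [h₈, h₉]
        constructor
        · rintro ⟨⟨hw, hs⟩, h0, h21, h01⟩
          have hs1 : ¬ ∃ p, s p = 1 := by
            intro hs1
            rcases h0 with h0 | h0
            · exact h01 (Or.inr (Or.inr ⟨h0, hs1⟩))
            · exact h01 (Or.inr (Or.inl (h₁₀ hs h0 hs1)))
          have hw21 : HasPair 2 1 w := by
            rcases h21 with h21 | h21 | h21
            · exact h21
            · exact absurd h21 (h₅ hs)
            · exact absurd h21.2 hs1
          by_cases hw0 : ∃ p, w p = 0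
          · exact Or.inl ⟨⟨hw, hw0, hw21, fun h => h01 (Or.inl h)⟩, hs, hs1⟩
          · exact Or.inr ⟨⟨hw, hw0, hw21⟩, ⟨hs, hs1⟩, h0.resolve_left hw0⟩
        · rintro (⟨⟨hw, hw0, hw21, hw01⟩, hs, hs1⟩ | ⟨⟨hw, hw0, hw21⟩, ⟨hs, hs1⟩, h0⟩)
          · refine ⟨⟨hw, hs⟩, Or.inl hw0, Or.inl hw21, ?_⟩
            rintro (h | h | h)
            exacts [hw01 h, hs1 (h₆ h), hs1 h.2]
          · refine ⟨⟨hw, hs⟩, Or.inr h0, Or.inl hw21, ?_⟩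
            rintro (h | h | h)
            exacts [hw0 (h₇ h), hs1 (h₆ h), hs1 h.2])
      (fun w h h' => by
        obtain ⟨p, hp⟩ := h.2.1
        have := h'.2.1 p
        omega)
    rw [ncard_monotone_words (by decide), ncard_monotone_words_used (by decide)] at this
    refine (congrArg Nat.cast this).trans ?_
    push_cast
    rw [ih, ncard_twoLetterWord m (by decide), subCount, subCountErase, psum]
    push_cast
    ring

theorem ncard_canonical (N : ℕ) :
    ({c | IsBlockMonotone (blockIndex m N) c ∧ IsCanonical c}.ncard : ℤ) =
      2 + subCountErase m N - subCount m N := by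
  rw [show {c | IsBlockMonotone (blockIndex m N) c ∧ IsCanonical c} =
    insert (fun _ => 0) ({c | IsBlockMonotone (blockIndex m N) c ∧ IsTwoLetterWord 0 1 c} ∪
      {c | IsBlockMonotone (blockIndex m N) c ∧ IsThreeLetterWord c}) from ?_,
    Set.ncard_insert_of_notMem, Set.ncard_union_eq]
  · push_cast
    rw [ncard_twoLetterWord m (by decide), ncard_threeLetterWord]
    ring
  · rw [Set.disjoint_left]
    rintro c ⟨-, h, -⟩ ⟨-, -, ⟨p, q, -, hp, -⟩, -⟩
    have := h p
    omega
  · rintro (⟨-, -, p, q, -, hp, -⟩ | ⟨-, -, ⟨p, q, -, hp, -⟩, -⟩) <;>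
      exact absurd hp (show ¬ (0 : Fin 3) = _ by decide)
  · ext c
    simp only [Set.mem_ofPred_eq, Set.mem_insert_iff, Set.mem_union, IsCanonical]
    constructor
    · tauto
    · rintro (rfl | h | h)
      · exact ⟨fun _ _ _ _ => le_rfl, Or.inl rfl⟩
      · tauto
      · tauto

end Count

end StackedGrid

/-! ### Coefficients of the quasisymmetric generating function. -/

namespace StackedGrid

variable {n : ℕ}

/-- The content of a sequence of indices. -/
noncomputable def content (i : Fin n → ℕ) : ℕ →₀ ℕ := ∑ k, Finsupp.single (i k) 1

theorem degree_content (i : Fin n → ℕ) : (content i).degree = n := by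
  simp [content]

theorem card_filter_lt (i : Fin n → ℕ) (v : ℕ) :
    (Finset.univ.filter (i · < v)).card = ∑ u ∈ Finset.range v, content i u := by
  rw [Finset.card_eq_sum_card_fiberwise (f := i) (t := Finset.range v)]
  · refine Finset.sum_congr rfl fun u hu => ?_
    rw [Finset.mem_range] at hu
    simp only [content, Finsupp.finsetSum_apply, Finsupp.single_apply, Finset.sum_boole,
      Nat.cast_id, Finset.filter_filter]
    congr 1
    ext k
    simp only [Finset.mem_filter, Finset.mem_univ, true_and]
    omega
  · intro k hk
    simpa using hk

/-- A weakly increasing sequence is determined by how many of its terms lie below each bound, and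
the content gives these numbers. -/
theorem eq_of_content_eq {i j : Fin n → ℕ} (hi : Monotone i) (hj : Monotone j)
    (h : content i = content j) : i = j := by
  funext k
  have key : ∀ v, i k < v ↔ j k < v := by
    intro v
    rw [← Tuple.lt_card_lt_iff_apply_lt_of_monotone hi,
      ← Tuple.lt_card_lt_iff_apply_lt_of_monotone hj, card_filter_lt, card_filter_lt, h]
  have h₁ := (key (i k + 1)).1 (by omega)
  have h₂ := (key (j k + 1)).2 (by omega)
  omega

theorem monotone_blockIndex (m : ℕ → ℕ) (N : ℕ) : Monotone (blockIndex m N) := by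
  induction N with
  | zero => exact fun _ _ _ => le_rfl
  | succ N ih =>
    rintro (p : Fin (psum m N + m N)) (q : Fin (psum m N + m N)) hpq
    rw [blockIndex]
    induction p using Fin.addCases with
    | left p =>
      induction q using Fin.addCases with
      | left q =>
        rw [Fin.append_left, Fin.append_left]
        exact ih hpq
      | right q =>
        rw [Fin.append_left, Fin.append_right]
        exact (blockIndex_lt m N p).le
    | right p =>
      induction q using Fin.addCases with
      | left q =>
        have : psum m N + (p : ℕ) ≤ q := hpq
        omega
      | right q =>
        rw [Fin.append_right, Fin.append_right]

theorem content_blockIndex (m : ℕ → ℕ) (N : ℕ) :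
    content (blockIndex m N) = ∑ k ∈ Finset.range N, Finsupp.single k (m k) := by
  induction N with
  | zero => exact Finset.sum_eq_zero fun p _ => absurd p.2 (Nat.not_lt_zero _)
  | succ N ih =>
    rw [Finset.sum_range_succ, ← ih]
    refine (Fin.sum_univ_add (fun p : Fin (psum m N + m N) =>
      Finsupp.single (blockIndex m (N + 1) p) 1)).trans ?_
    simp only [blockIndex, Fin.append_left, Fin.append_right]
    simp [content]

theorem content_blockIndex_eq (f : ℕ →₀ ℕ) {N : ℕ} (hf : ∀ k, N ≤ k → f k = 0) :
    content (blockIndex f N) = f := by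
  rw [content_blockIndex]
  ext k
  simp only [Finsupp.finsetSum_apply, Finsupp.single_apply, Finset.sum_ite_eq', Finset.mem_range]
  split_ifs with h
  · rfl
  · exact (hf k (not_lt.1 h)).symm

theorem psum_eq_degree (f : ℕ →₀ ℕ) {N : ℕ} (hf : ∀ k, N ≤ k → f k = 0) :
    psum f N = f.degree := by
  rw [← degree_content (blockIndex f N), content_blockIndex_eq f hf]

open Classical in
theorem coeff_fundamentalQSym (f : ℕ →₀ ℕ) {i : Fin n → ℕ} (hi : Monotone i)
    (hif : content i = f) (D : Finset (Fin (n - 1))) :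
    MvPowerSeries.coeff f (fundamentalQSym n D) = if IsIndexSeq D i then 1 else 0 := by
  change ((Nat.card {j : Fin n → ℕ // IsIndexSeq D j ∧ content j = f} : ℕ) : ℚ) = _
  have h : ∀ j : {j : Fin n → ℕ // IsIndexSeq D j ∧ content j = f}, j.1 = i := fun j =>
    eq_of_content_eq j.2.1.1 hi (j.2.2.trans hif.symm)
  split_ifs with hD
  · have : Unique {j : Fin n → ℕ // IsIndexSeq D j ∧ content j = f} :=
      ⟨⟨⟨i, hD, hif⟩⟩, fun j => Subtype.ext (h j)⟩
    rw [Nat.card_unique, Nat.cast_one]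
  · have : IsEmpty {j : Fin n → ℕ // IsIndexSeq D j ∧ content j = f} :=
      ⟨fun j => hD (h j ▸ j.2.1)⟩
    rw [Nat.card_of_isEmpty, Nat.cast_zero]

theorem coeff_fundamentalQSym_of_degree_ne (f : ℕ →₀ ℕ) (hf : f.degree ≠ n)
    (D : Finset (Fin (n - 1))) : MvPowerSeries.coeff f (fundamentalQSym n D) = 0 := by
  change ((Nat.card {j : Fin n → ℕ // IsIndexSeq D j ∧ content j = f} : ℕ) : ℚ) = _
  have : IsEmpty {j : Fin n → ℕ // IsIndexSeq D j ∧ content j = f} :=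
    ⟨fun j => hf (by rw [← j.2.2, degree_content])⟩
  rw [Nat.card_of_isEmpty, Nat.cast_zero]

/-- The fibres of a monotone `i` are intervals of positions, so having no descent inside a fibre
amounts to increasing on it. -/
theorem isIndexSeq_des_iff {i : Fin n → ℕ} (hi : Monotone i) (π : Equiv.Perm (Fin n)) :
    IsIndexSeq (Des π) i ↔ ∀ p q, p < q → i p = i q → π p < π q := by
  constructor
  · rintro ⟨-, h⟩ p q hpq hpq'
    -- Induction on the distance, passing through the position just before `q`, which lies in the
    -- same fibre by monotonicity.
    have key : ∀ d : ℕ, ∀ q : Fin n, (q : ℕ) = p + d + 1 → i p = i q → π p < π q := by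
      intro d
      induction d with
      | zero =>
        intro q hq hiq
        by_contra hlt
        have hne : π p ≠ π q := fun h' => by
          have := π.injective h'
          omega
        have := h ⟨p, by omega⟩ (by
          simp only [Des, Finset.mem_filter, Finset.mem_univ, true_and]
          rw [show (⟨(p : ℕ) + 1, _⟩ : Fin n) = q from Fin.ext hq.symm]
          exact lt_of_le_of_ne (not_lt.1 hlt) hne.symm)
        simp only [show (⟨(p : ℕ) + 1, by omega⟩ : Fin n) = q from Fin.ext hq.symm] at this
        exact this.ne hiq
      | succ d ih =>
        intro q hq hiq
        let r : Fin n := ⟨p + d + 1, by omega⟩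
        have h₁ : i p ≤ i r := hi (Fin.le_def.2 (by simp only [r]; omega))
        have h₂ : i r ≤ i q := hi (Fin.le_def.2 (by simp only [r]; omega))
        refine (ih r rfl (by omega)).trans ?_
        by_contra hlt
        have hne : π r ≠ π q := fun h' => by
          have := congrArg Fin.val (π.injective h')
          simp only [r] at this
          omega
        have hrq : (⟨(r : ℕ) + 1, by simp only [r]; omega⟩ : Fin n) = q :=
          Fin.ext (by simp only [r]; omega)
        have := h ⟨r, by simp only [r]; omega⟩ (by
          simp only [Des, Finset.mem_filter, Finset.mem_univ, true_and]
          rw [hrq]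
          exact lt_of_le_of_ne (not_lt.1 hlt) hne.symm)
        simp only [hrq] at this
        have h₃ : i r < i q := this
        omega
    exact key (q - p - 1) q (by omega) hpq'
  · intro h
    refine ⟨hi, fun j hj => ?_⟩
    simp only [Des, Finset.mem_filter, Finset.mem_univ, true_and] at hj
    refine (hi (Fin.le_def.2 (Nat.le_succ _))).lt_of_ne fun h' => ?_
    exact lt_asymm hj (h _ _ (Fin.lt_def.2 (Nat.lt_succ_self _)) h')

theorem coeff_quasiGen_classJ (n N : ℕ) (f : ℕ →₀ ℕ) (hf : ∀ k, N ≤ k → f k = 0) :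
    MvPowerSeries.coeff f (quasiGen (classJ n)) =
      if psum f N = n then ((2 + subCountErase f N - subCount f N : ℤ) : ℚ) else 0 := by
  classical
  rw [quasiGen, map_sum]
  split_ifs with h
  · subst h
    have hi := monotone_blockIndex f N
    simp only [coeff_fundamentalQSym f hi (content_blockIndex_eq f hf), isIndexSeq_des_iff hi]
    rw [Finset.sum_boole, ← ncard_canonical, ← ncard_classJ, Finset.filter_filter,
      ← Set.ncard_coe_finset, Finset.coe_filter]
    simp
  · exact Finset.sum_eq_zero fun π _ => coeff_fundamentalQSym_of_degree_ne f
      (by rwa [← psum_eq_degree f hf]) _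

theorem exists_bound (f : ℕ →₀ ℕ) : ∃ N, ∀ k, N ≤ k → f k = 0 := by
  refine ⟨f.support.sup id + 1, fun k hk => ?_⟩
  by_contra h
  have := Finset.le_sup (f := id) (Finsupp.mem_support_iff.2 h)
  simp only [id] at this
  omega

theorem quasiGen_classJ (n : ℕ) : quasiGen (classJ n) = schurSide n := by
  ext f
  obtain ⟨N, hN⟩ := exists_bound f
  rw [coeff_quasiGen_classJ n N f hN, coeff_schurSide n N f hN]

/-! ### Symmetry of the generating function. -/

theorem subCount_eq_prod (f : ℕ →₀ ℕ) {N : ℕ} (hf : ∀ k, N ≤ k → f k = 0) :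
    (subCount f N : ℚ) = f.prod fun _ e => (e : ℚ) + 1 := by
  rw [Finsupp.prod_of_support_subset f (s := Finset.range N) _ _ (by simp)]
  · clear hf
    induction N with
    | zero => simp [subCount]
    | succ N ih =>
      rw [Finset.prod_range_succ, ← ih, subCount]
      push_cast
      ring
  · intro k hk
    rw [Finset.mem_range]
    by_contra h
    exact Finsupp.mem_support_iff.1 hk (hf k (not_lt.1 h))

/-- Dividing by `e + 1` removes one factor from the full product, which puts the count in a form
visibly invariant under permuting the variables. -/
theorem subCountErase_eq (f : ℕ →₀ ℕ) {N : ℕ} (hf : ∀ k, N ≤ k → f k = 0) :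
    (subCountErase f N : ℚ) =
      (f.prod fun _ e => (e : ℚ) + 1) * f.sum fun _ e => (e : ℚ) / (e + 1) := by
  rw [← subCount_eq_prod f hf, Finsupp.sum_of_support_subset f (s := Finset.range N) _ _ (by simp)]
  · clear hf
    induction N with
    | zero => simp [subCountErase]
    | succ N ih =>
      rw [Finset.sum_range_succ, subCountErase, subCount]
      push_cast
      rw [ih]
      field_simp
  · intro k hk
    rw [Finset.mem_range]
    by_contra h
    exact Finsupp.mem_support_iff.1 hk (hf k (not_lt.1 h))

theorem coeff_quasiGen_classJ_eq (n : ℕ) (f : ℕ →₀ ℕ) :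
    MvPowerSeries.coeff f (quasiGen (classJ n)) =
      if f.degree = n then 2 + (f.prod fun _ e => (e : ℚ) + 1) *
        (f.sum fun _ e => (e : ℚ) / (e + 1)) - f.prod fun _ e => (e : ℚ) + 1 else 0 := by
  obtain ⟨N, hN⟩ := exists_bound f
  rw [coeff_quasiGen_classJ n N f hN, psum_eq_degree f hN, ← subCountErase_eq f hN,
    ← subCount_eq_prod f hN]
  push_cast
  rfl

theorem isSymmetricFunction_quasiGen_classJ (n : ℕ) :
    IsSymmetricFunction n (quasiGen (classJ n)) := by
  constructor
  · intro f hf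
    rw [coeff_quasiGen_classJ_eq] at hf
    by_contra h
    exact hf (if_neg h)
  · intro σ f
    rw [coeff_quasiGen_classJ_eq, coeff_quasiGen_classJ_eq, Finsupp.degree_mapDomain,
      Finsupp.prod_mapDomain_index_inj σ.injective, Finsupp.sum_mapDomain_index_inj σ.injective]

end StackedGrid

theorem proposition7p7 (n : ℕ) :
    StackedGrid.IsFine (StackedGrid.classJ n) ∧
    StackedGrid.quasiGen (StackedGrid.classJ n) =
      StackedGrid.schurOfRows [n]
      + ∑ a ∈ Finset.Icc 1 (n / 2),
          ((n : ℚ) - 2 * (a : ℚ) + 1) • StackedGrid.schurOfRows [n - a, a]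
      + ∑ a ∈ Finset.Icc 1 ((n - 1) / 2),
          ((n : ℚ) - 2 * (a : ℚ)) • StackedGrid.schurOfRows [n - a - 1, a, 1] := by
  have h := StackedGrid.quasiGen_classJ n
  exact ⟨⟨StackedGrid.isSymmetricFunction_quasiGen_classJ n,
    h ▸ StackedGrid.isSchurPositive_schurSide n⟩, h⟩
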